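/- Let $\alpha,\beta>0$ satisfy $\min\{\alpha+3\beta,\,3\alpha+\beta\}\ge 4\alpha\beta$, and let $\theta_0\in L^2(\mathbb R^2)$ be real-valued. Consider the surface quasi-geostrophic equation with anisotropic fractional dissipation $$\partial_t\theta+(u\cdot\nabla)\theta+\mathcal L\theta=0,\qquad u=(-\mathcal R_2\theta,\mathcal R_1\theta),\qquad \theta(\cdot,0)=\theta_0,\qquad x\in\mathbb R^2,\ t>0,$$ where $\mathcal R_j=\partial_{x_j}\Lambda^{-1}$ is the Fourier multiplier with symbol $i\xi_j/|\xi|$ and $\mathcal L=\Lambda_{x_1}^{2\alpha}+\Lambda_{x_2}^{2\beta}$ is the Fourier multiplier with symbol $m(\xi)=|\xi_1|^{2\alpha}+|\xi_2|^{2\beta}$. Then every weak solution $\theta$ satisfies $$\lim_{t\to\infty}\|\theta(t)\|_{L^2}=0 .$$ If $\alpha=\beta$, the same holds with $\mathcal L=\Lambda^{2\alpha}=(-\Delta)^{\alpha}$, that is, with $m(\xi)=|\xi|^{2\alpha}$. Here a weak solution is a global weak solution of Leray–Hopf type: a function $\theta:[0,\infty)\to L^2(\mathbb R^2)$ with real-valued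 values, strongly measurable, such that 1. for every Schwartz function $\varphi$ and every $t\ge 0$, $$\int\theta(t)\varphi\,dx-\int\theta_0\varphi\,dx=\int_0^t\Big(\int\theta\,u\cdot\nabla\varphi\,dx-\int\theta\,\mathcal L\varphi\,dx\Big)d\tau;$$ 2. the energy inequality $$\|\theta(t)\|_{L^2}^2+2\int_s^t\big\|\mathcal L^{1/2}\theta(\tau)\big\|_{L^2}^2\,d\tau\le\|\theta(s)\|_{L^2}^2,\qquad \big\|\mathcal L^{1/2}\theta\big\|_{L^2}^2=\|\sqrt m\,\widehat\theta\,\|_{L^2}^2 \ \text{ (with the normalization of } \widehat{\ } \text{ that is an isometry of } L^2),$$ holds for all $t\ge s$, for $s=0$ (with $\theta_0$ in place of $\theta(s)$) and for almost every $s>0$. For $\mathcal L=\Lambda_{x_1}^{2\alpha}+\Lambda_{x_2}^{2\beta}$ the dissipation is $\|\mathcal L^{1/2}\theta\|_{L^2}^2=\|\Lambda_{x_1}^{\alpha}\theta\|_{L^2}^2+\|\Lambda_{x_2}^{\beta}\theta\|_{L^2}^2$. -/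

import Mathlib

open MeasureTheory Filter Topology SchwartzMap FourierTransform LineDeriv
open scoped ENNReal

noncomputable section

namespace SQG

/-- The Euclidean plane `ℝ²`; the coordinates `x₁, x₂` are `x 0, x 1`. -/
abbrev Plane : Type := EuclideanSpace ℝ (Fin 2)

/-- Real-valued `L²(ℝ²)`. -/
abbrev L2 : Type := Lp ℝ 2 (volume : Measure Plane)

/-- Complex-valued `L²(ℝ²)`, on which Mathlib's `L²` Fourier transform acts. -/
abbrev L2C : Type := Lp ℂ 2 (volume : Measure Plane)

/-- A real-valued `L²` function regarded as a complex-valued one. -/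
def toComplex (f : L2) : L2C := Complex.ofRealCLM.compLp f

/-- The frequency for the convention `f̂(ξ) = ∫ e^{-i x·ξ} f(x) dx` (up to a constant factor) which
belongs to the variable of Mathlib's Fourier transform `∫ e^{-2πi x·ξ} f(x) dx`. -/
def freq (ξ : Plane) : Plane := (2 * Real.pi) • ξ

/-- The Fourier multiplier `m(D)` on `L²(ℝ²)`, that is `(m(D) f)^ (ξ) = m(ξ) f̂(ξ)`, for `f` in its
natural domain `{f ∈ L² : m f̂ ∈ L²}` (and `0` off the domain). -/
def fourierMul (m : Plane → ℂ) (f : L2C) : L2C :=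
  open Classical in
  if h : MemLp (fun ξ : Plane => m (freq ξ) * (𝓕 f : L2C) ξ) 2 (volume : Measure Plane) then
    𝓕⁻ (h.toLp (fun ξ : Plane => m (freq ξ) * (𝓕 f : L2C) ξ))
  else 0

/-- The symbol `i ξ_j / |ξ|` of the Riesz transform `R_j = ∂_j Λ⁻¹`. -/
def rieszSymbol (j : Fin 2) (ξ : Plane) : ℂ := Complex.I * (ξ j : ℂ) / (‖ξ‖ : ℂ)

/-- The Riesz transform `R_j` on `L²(ℝ²)`. -/
def riesz (j : Fin 2) (f : L2C) : L2C := fourierMul (rieszSymbol j) f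

/-- The velocity `u = (u₁, u₂) = (-R₂ θ, R₁ θ)`. -/
def velocity (θ : L2) : Fin 2 → L2C := ![-riesz 1 (toComplex θ), riesz 0 (toComplex θ)]

/-- The symbol `|ξ₁|^{2α} + |ξ₂|^{2β}` of `Λ_{x₁}^{2α} + Λ_{x₂}^{2β}`. -/
def anisoSymbol (α β : ℝ) (ξ : Plane) : ℝ := |ξ 0| ^ (2 * α) + |ξ 1| ^ (2 * β)

/-- The symbol `|ξ|^{2α}` of `Λ^{2α} = (-Δ)^α`. -/
def isoSymbol (α : ℝ) (ξ : Plane) : ℝ := ‖ξ‖ ^ (2 * α)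

/-- The dissipation operator `m(D)` applied to a test function. -/
def dissOp (m : Plane → ℝ) (φ : 𝓢(Plane, ℂ)) : L2C :=
  fourierMul (fun ξ => (m ξ : ℂ)) (φ.toLp 2 (volume : Measure Plane))

/-- `fourierMul` never leaves its domain in the definition of the Riesz transforms. -/
theorem memLp_riesz (j : Fin 2) (f : L2C) :
    MemLp (fun ξ : Plane => rieszSymbol j (freq ξ) * (𝓕 f : L2C) ξ) 2
      (volume : Measure Plane) := by
  refine MemLp.of_le (Lp.memLp (𝓕 f : L2C)) ?_ (Eventually.of_forall fun ξ => ?_)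
  · refine AEStronglyMeasurable.mul ?_ (Lp.aestronglyMeasurable _)
    refine Measurable.aestronglyMeasurable ?_
    unfold rieszSymbol freq
    fun_prop
  · have h : ‖rieszSymbol j (freq ξ)‖ ≤ 1 := by
      have := EuclideanSpace.norm_eq (freq ξ)
      simp only [rieszSymbol, norm_div, norm_mul, Complex.norm_I, one_mul, Complex.norm_real,
        norm_norm]
      exact div_le_one_of_le₀ (PiLp.norm_apply_le (freq ξ) j) (norm_nonneg _)
    rw [norm_mul]
    exact mul_le_of_le_one_left (norm_nonneg _) h

/-- Schwartz functions are in the domain of `m(D)` if `m` has polynomial growth. -/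
theorem memLp_symbol {m : Plane → ℝ} (hm : Measurable m) (k : ℕ) (C : ℝ)
    (hb : ∀ ξ, |m ξ| ≤ C * (1 + ‖ξ‖) ^ k) (φ : 𝓢(Plane, ℂ)) :
    MemLp (fun ξ : Plane => (m (freq ξ) : ℂ) *
      (𝓕 (φ.toLp 2 (volume : Measure Plane)) : L2C) ξ) 2 (volume : Measure Plane) := by
  rw [SchwartzMap.toLp_fourier_eq]
  have hae : (fun ξ : Plane => (m (freq ξ) : ℂ) * ((𝓕 φ).toLp 2 (volume : Measure Plane) : L2C) ξ)
      =ᵐ[volume] fun ξ => (m (freq ξ) : ℂ) * (𝓕 φ) ξ := by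
    filter_upwards [SchwartzMap.coeFn_toLp (𝓕 φ) 2 (volume : Measure Plane)] with ξ h
    rw [h]
  rw [memLp_congr_ae hae]
  have hg : Function.HasTemperateGrowth (fun ξ : Plane => (((1 + ‖freq ξ‖ ^ 2) ^ k : ℝ) : ℂ)) := by
    simp only [freq, norm_smul, mul_pow]
    fun_prop
  have h2 := ((SchwartzMap.smulLeftCLM ℂ (fun ξ : Plane => (((1 + ‖freq ξ‖ ^ 2) ^ k : ℝ) : ℂ))
    (𝓕 φ)).memLp 2 (volume : Measure Plane)).const_mul ((C * 2 ^ k : ℝ) : ℂ)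
  refine MemLp.of_le h2 ?_ (Eventually.of_forall fun ξ => ?_)
  · refine AEStronglyMeasurable.mul ?_ (𝓕 φ).continuous.aestronglyMeasurable
    refine Measurable.aestronglyMeasurable ?_
    unfold freq
    fun_prop
  · have hC : 0 ≤ C := by simpa using (abs_nonneg _).trans (hb 0)
    rw [SchwartzMap.smulLeftCLM_apply_apply hg]
    simp only [norm_mul, smul_eq_mul, Complex.norm_real]
    rw [← mul_assoc]
    gcongr
    rw [Real.norm_eq_abs]
    refine (hb _).trans ?_
    rw [Real.norm_of_nonneg hC, Real.norm_of_nonneg (r := (2 : ℝ) ^ k) (by positivity), mul_assoc]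
    refine mul_le_mul_of_nonneg_left ?_ hC
    rw [Real.norm_of_nonneg (r := (1 + ‖freq ξ‖ ^ 2) ^ k) (by positivity), ← mul_pow]
    gcongr
    nlinarith [sq_nonneg (‖freq ξ‖ - 1)]

/-- `anisoSymbol` has polynomial growth, so `dissOp` stays in the domain of `fourierMul`. -/
theorem aniso_bound {α β : ℝ} (hα : 0 < α) (hβ : 0 < β) (ξ : Plane) :
    |anisoSymbol α β ξ| ≤ 2 * (1 + ‖ξ‖) ^ (⌈2 * α⌉₊ + ⌈2 * β⌉₊) := by
  have key : ∀ (j : Fin 2) (a : ℝ) (k : ℕ), 0 < a → a ≤ k → |ξ j| ^ a ≤ (1 + ‖ξ‖) ^ k := by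
    intro j a k ha hk
    have h1 : |ξ j| ≤ 1 + ‖ξ‖ := by
      have := PiLp.norm_apply_le ξ j
      rw [Real.norm_eq_abs] at this; linarith
    calc |ξ j| ^ a ≤ (1 + ‖ξ‖) ^ a := by gcongr
      _ ≤ (1 + ‖ξ‖) ^ (k : ℝ) := by gcongr; linarith [norm_nonneg ξ]
      _ = _ := Real.rpow_natCast _ _
  have a1 := key 0 (2 * α) (⌈2 * α⌉₊ + ⌈2 * β⌉₊) (by positivity)
    (by push_cast; linarith [Nat.le_ceil (2 * α), Nat.cast_nonneg (α := ℝ) ⌈2 * β⌉₊])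
  have a2 := key 1 (2 * β) (⌈2 * α⌉₊ + ⌈2 * β⌉₊) (by positivity)
    (by push_cast; linarith [Nat.le_ceil (2 * β), Nat.cast_nonneg (α := ℝ) ⌈2 * α⌉₊])
  rw [anisoSymbol, abs_of_nonneg (by positivity)]
  linarith

/-- `isoSymbol` has polynomial growth, so `dissOp` stays in the domain of `fourierMul`. -/
theorem iso_bound {α : ℝ} (hα : 0 < α) (ξ : Plane) :
    |isoSymbol α ξ| ≤ 1 * (1 + ‖ξ‖) ^ ⌈2 * α⌉₊ := by
  rw [isoSymbol, abs_of_nonneg (by positivity), one_mul]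
  calc ‖ξ‖ ^ (2 * α) ≤ (1 + ‖ξ‖) ^ (2 * α) := by gcongr; linarith
      _ ≤ (1 + ‖ξ‖) ^ (⌈2 * α⌉₊ : ℝ) := by gcongr; linarith [norm_nonneg ξ]; exact Nat.le_ceil _
      _ = _ := Real.rpow_natCast _ _

theorem aniso_measurable (α β : ℝ) : Measurable (anisoSymbol α β) := by
  unfold anisoSymbol
  fun_prop

theorem iso_measurable (α : ℝ) : Measurable (isoSymbol α) := by
  unfold isoSymbol
  fun_prop

/-- The dissipation `∫ m(ξ) |θ̂(ξ)|² dξ ∈ [0, ∞]` of `θ`. With Plancherel's theorem it is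
`‖Λ_{x₁}^α θ‖² + ‖Λ_{x₂}^β θ‖²` for `m = anisoSymbol α β` and `‖Λ^α θ‖²` for `m = isoSymbol α`
(squared `L²` norms), and it is `∞` if one of these functions is not in `L²`. -/
def dissipation (m : Plane → ℝ) (θ : L2) : ℝ≥0∞ :=
  ∫⁻ ξ : Plane, ENNReal.ofReal (m (freq ξ)) * ‖(𝓕 (toComplex θ) : L2C) ξ‖ₑ ^ 2

/-- The energy inequality between the times `s` and `t`, where the state at time `s` is `θs`:
`‖θ(t)‖² + 2 ∫_s^t ∫ m(ξ) |θ̂(ξ, τ)|² dξ dτ ≤ ‖θs‖²`. -/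
def EnergyInequality (m : Plane → ℝ) (θ : ℝ → L2) (s t : ℝ) (θs : L2) : Prop :=
  ENNReal.ofReal (‖θ t‖ ^ 2) + 2 * ∫⁻ τ in Set.Ioc s t, dissipation m (θ τ) ≤
    ENNReal.ofReal (‖θs‖ ^ 2)

/-- `θ` (restricted to times `t ≥ 0`) is a global (Leray-Hopf) weak solution of
`∂_t θ + (u · ∇) θ + m(D) θ = 0`, `u = (-R₂ θ, R₁ θ)`, `θ(0) = θ₀`. -/
structure IsWeakSolution (m : Plane → ℝ) (θ₀ : L2) (θ : ℝ → L2) : Prop where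
  /-- `θ` is strongly measurable in time with values in `L²`. -/
  aestronglyMeasurable : AEStronglyMeasurable θ (volume.restrict (Set.Ioi (0 : ℝ)))
  /-- The equation, in divergence form, holds when tested with Schwartz functions:
  `∫ θ(t) φ - ∫ θ₀ φ = ∫_0^t (∫ θ u · ∇φ - ∫ θ m(D)φ) dτ`. -/
  weak_form : ∀ φ : 𝓢(Plane, ℂ), ∀ t : ℝ, 0 ≤ t →
    (∫ x : Plane, (θ t x : ℂ) * φ x) - (∫ x : Plane, (θ₀ x : ℂ) * φ x) =
      ∫ τ in (0 : ℝ)..t,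
        ((∫ x : Plane, (θ τ x : ℂ) *
            ∑ j : Fin 2, velocity (θ τ) j x * (∂_{EuclideanSpace.single j (1 : ℝ)} φ) x) -
          ∫ x : Plane, (θ τ x : ℂ) * dissOp m φ x)
  /-- The energy inequality from the initial time. -/
  energy_zero : ∀ t : ℝ, 0 ≤ t → EnergyInequality m θ 0 t θ₀
  /-- The energy inequality from almost every later time. -/
  energy_ae : ∀ᵐ s ∂(volume.restrict (Set.Ioi (0 : ℝ))), ∀ t : ℝ, s ≤ t →
    EnergyInequality m θ s t (θ s)

end SQG

end

/-! The dissipation is integrable in time, so it is small at some arbitrarily late times. Away from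
the origin the symbol is bounded below, so at such times the high-frequency energy is small. The
real danger is energy accumulating near frequency zero, and the proof bounds the flux of energy into
low frequencies.

On the Fourier side the transport term, tested against the low-frequency part of the solution, is a
trilinear integral over frequencies `ξ = (ξ - ζ) + ζ`. The Riesz symbols are bounded by one and the
divergence form supplies a factor of the output frequency `ξ`; no further cancellation is used. With
`|ξ₁| ≤ M ^ a` and `|ξ₂| ≤ M ^ b`, the sublevel set `{M ≤ r}` has measure at most `4 r ^ (a + b)`.
Integrating the lowest of the three frequencies by Cauchy–Schwarz gains `r ^ ((a + b) / 2)`, and the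
output factor gains `r ^ a` or `r ^ b`. The hypothesis on the exponents says exactly that both
totals are at least one power of `r`, so the flux is at most a constant times the `L²` norm times
the dissipation (`IsDissipative.trilinear_le`, `ofReal_re_weakRHS_le`). This constant does not
depend on the cutoff.

A weak solution cannot be used directly as its own test function. Its frequency cutoff is Lipschitz
in time, which gives the low-frequency energy inequality up to a quadratic error on short intervals
(`exists_cut_energy_le`); subdivision removes the error (`ofReal_sub_le_of_local`).

For the conclusion (`eventually_norm_sq_le`), take `s` so late that the remaining dissipation is
tiny, and only then a cutoff so narrow that the low-frequency energy at time `s` is tiny. It stays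
tiny after `s`. At a later time of small dissipation the whole energy is small, and the energy
inequality from that time keeps it small. -/

namespace SQG

/-! ### The trilinear estimate in frequency space. -/

/-- The properties of the dissipation symbol, as a function of the variable of Mathlib's Fourier
transform, on which the decay of the energy rests: near the origin it dominates the anisotropic
polynomial `|ξ₁|^{1/a} + |ξ₂|^{1/b}`. -/
structure IsDissipative (M : Plane → ℝ) (a b K : ℝ) : Prop where
  measurable : Measurable M
  nonneg : ∀ ξ, 0 ≤ M ξ
  even : ∀ ξ, M (-ξ) = M ξ
  abs_zero_le : ∀ ξ, |ξ 0| ≤ M ξ ^ a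
  abs_one_le : ∀ ξ, |ξ 1| ≤ M ξ ^ b
  quasi_add : ∀ ξ η, M (ξ + η) ≤ K * (M ξ + M η)
  eventually_le_one : ∀ᶠ ξ in 𝓝 (0 : Plane), M ξ ≤ 1
  pos_left : 0 < a
  pos_right : 0 < b
  two_le_left : 2 ≤ 3 * a + b
  two_le_right : 2 ≤ a + 3 * b

/-- Weight of a pair of frequencies of which the first one is the lower one. -/
noncomputable def pairWeight (M : Plane → ℝ) (c : ℝ) (p q : Plane) : ℝ≥0∞ :=
  if M p ≤ min (M q) 1 then ENNReal.ofReal (min (M q) 1 ^ c) else 0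

theorem measurable_pairWeight {M : Plane → ℝ} (hM : Measurable M) (c : ℝ) :
    Measurable (Function.uncurry (pairWeight M c)) := by
  unfold pairWeight Function.uncurry
  refine Measurable.ite (measurableSet_le ?_ ?_) ?_ measurable_const <;> fun_prop

theorem mul_le_sq_add_sq (u v : ℝ≥0∞) : u * v ≤ u ^ 2 + v ^ 2 := by
  rcases le_total u v with h | h
  · calc u * v ≤ v * v := by gcongr
      _ = v ^ 2 := (sq v).symm
      _ ≤ _ := le_add_self
  · calc u * v ≤ u * u := by gcongr
      _ = u ^ 2 := (sq u).symm
      _ ≤ _ := le_self_add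

/-- Here `u` is meant for the factor of lowest frequency: it stays linear, while the other two are
separated into squares, each with its own weight. -/
theorem mul_mul_le_pair {r D A w₁ w₂ u v₁ v₂ : ℝ≥0∞} (h₁ : r ≤ D * w₁) (h₂ : r ≤ D * w₂)
    (hA : w₁ * u * v₁ ^ 2 + w₂ * u * v₂ ^ 2 ≤ A) : r * u * (v₁ * v₂) ≤ D * A := by
  calc r * u * (v₁ * v₂) ≤ r * u * (v₁ ^ 2 + v₂ ^ 2) := by gcongr; exact mul_le_sq_add_sq _ _
    _ = r * (u * v₁ ^ 2) + r * (u * v₂ ^ 2) := by ring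
    _ ≤ D * w₁ * (u * v₁ ^ 2) + D * w₂ * (u * v₂ ^ 2) := by gcongr
    _ = D * (w₁ * u * v₁ ^ 2 + w₂ * u * v₂ ^ 2) := by ring
    _ ≤ _ := by gcongr

section

variable {M : Plane → ℝ} {a b K : ℝ}

/-- Order the three frequencies by `M` and pair the lowest with each of the other two. The output
weight `M x ^ c` is controlled by either higher frequency because `x = y + z` and `M` is
quasi-subadditive. The six terms cover every possible ordering. -/
theorem IsDissipative.triple_le (h : IsDissipative M a b K) {c : ℝ} (hc : 0 < c) {ω : Plane → ℝ}
    (hω : ∀ ξ, ω ξ ≤ M ξ ^ c) (f : Plane → ℝ≥0∞) {x y z : Plane} (hxyz : x = y + z)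
    (hx : M x ≤ 1) :
    ENNReal.ofReal (ω x) * f x * f y * f z ≤ ENNReal.ofReal (max 1 (2 * K) ^ c) *
      (pairWeight M c x y * f x * f y ^ 2 + pairWeight M c x z * f x * f z ^ 2 +
        pairWeight M c y x * f y * f x ^ 2 + pairWeight M c y z * f y * f z ^ 2 +
        pairWeight M c z x * f z * f x ^ 2 + pairWeight M c z y * f z * f y ^ 2) := by
  have hD : 1 ≤ max 1 (2 * K) := le_max_left _ _
  have low : ∀ q, M x ≤ M q → ENNReal.ofReal (ω x) ≤
      ENNReal.ofReal (max 1 (2 * K) ^ c) * pairWeight M c x q := by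
    intro q hq
    rw [pairWeight, if_pos (le_min hq hx), ← ENNReal.ofReal_mul (by positivity)]
    refine ENNReal.ofReal_le_ofReal ((hω x).trans ?_)
    calc M x ^ c ≤ min (M q) 1 ^ c := by
          gcongr
          · exact h.nonneg x
          · exact le_min hq hx
      _ ≤ _ := le_mul_of_one_le_left (Real.rpow_nonneg (le_min (h.nonneg q) zero_le_one) _)
        (Real.one_le_rpow hD hc.le)
  have high : ∀ p q, M p ≤ M q → M p ≤ M x → M x ≤ max 1 (2 * K) * M q →
      ENNReal.ofReal (ω x) ≤ ENNReal.ofReal (max 1 (2 * K) ^ c) * pairWeight M c p q := by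
    intro p q hpq hpx hxq
    have hmin : 0 ≤ min (M q) 1 := le_min (h.nonneg q) zero_le_one
    rw [pairWeight, if_pos (le_min hpq (hpx.trans hx)), ← ENNReal.ofReal_mul (by positivity),
      ← Real.mul_rpow (by positivity) hmin]
    refine ENNReal.ofReal_le_ofReal ((hω x).trans ?_)
    gcongr
    · exact h.nonneg x
    · rw [mul_min_of_nonneg _ _ (by positivity), mul_one]
      exact le_min hxq (hx.trans hD)
  have quasi : ∀ p q, x = p + q → M p ≤ M q → M x ≤ max 1 (2 * K) * M q := by
    intro p q hpq hle
    have h1 := h.quasi_add p q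
    rw [← hpq] at h1
    have h2 : 2 * K * M q ≤ max 1 (2 * K) * M q :=
      mul_le_mul_of_nonneg_right (le_max_right _ _) (h.nonneg q)
    rcases le_or_gt 0 K with hK | hK
    · nlinarith [mul_le_mul_of_nonneg_left hle hK]
    · nlinarith [h.nonneg p, h.nonneg q, h.nonneg x,
        mul_nonneg (zero_le_one.trans hD) (h.nonneg q)]
  have self : M x ≤ max 1 (2 * K) * M x := le_mul_of_one_le_left (h.nonneg x) hD
  set r := ENNReal.ofReal (ω x)
  -- The lowest frequency is `x`, `y`, `x` or `z` in the four cases below.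
  rcases le_total (M y) (M z) with hyz | hyz
  · rcases le_total (M x) (M y) with hxy | hxy
    · calc r * f x * f y * f z = r * f x * (f y * f z) := by ring
        _ ≤ _ := mul_mul_le_pair (low y hxy) (low z (hxy.trans hyz)) <| by
          simp only [add_assoc]; gcongr; exact le_self_add
    · calc r * f x * f y * f z = r * f y * (f x * f z) := by ring
        _ ≤ _ := mul_mul_le_pair (high y x hxy hxy self)
            (high y z hyz hxy (quasi y z hxyz hyz)) <| by
          calc _ ≤ pairWeight M c x y * f x * f y ^ 2 + pairWeight M c x z * f x * f z ^ 2 +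
              (pairWeight M c y x * f y * f x ^ 2 + pairWeight M c y z * f y * f z ^ 2) :=
                le_add_self
            _ ≤ _ := by rw [← add_assoc, add_assoc (_ + _ + _ + _)]; exact le_self_add
  · rcases le_total (M x) (M z) with hxz | hxz
    · calc r * f x * f y * f z = r * f x * (f y * f z) := by ring
        _ ≤ _ := mul_mul_le_pair (low y (hxz.trans hyz)) (low z hxz) <| by
          simp only [add_assoc]; gcongr; exact le_self_add
    · calc r * f x * f y * f z = r * f z * (f x * f y) := by ring
        _ ≤ _ := mul_mul_le_pair (high z x hxz hxz self)
            (high z y hyz hxz (quasi z y (by rw [hxyz, add_comm]) hyz)) <| by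
          rw [add_assoc]
          exact le_add_self

/-- The sublevel set lies in a box with sides `2 r ^ a` and `2 r ^ b`. -/
theorem IsDissipative.volume_le (h : IsDissipative M a b K) {r : ℝ} (hr : 0 ≤ r) :
    volume {p | M p ≤ r} ≤ ENNReal.ofReal (4 * r ^ (a + b)) := by
  have hsub : {p | M p ≤ r} ⊆ (@WithLp.ofLp 2 (Fin 2 → ℝ)) ⁻¹'
      Set.Icc ![-r ^ a, -r ^ b] ![r ^ a, r ^ b] := by
    intro p hp
    have h0 : |p 0| ≤ r ^ a := (h.abs_zero_le p).trans
      (Real.rpow_le_rpow (h.nonneg p) hp h.pos_left.le)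
    have h1 : |p 1| ≤ r ^ b := (h.abs_one_le p).trans
      (Real.rpow_le_rpow (h.nonneg p) hp h.pos_right.le)
    rw [abs_le] at h0 h1
    simp only [Set.mem_preimage, Set.mem_Icc, Pi.le_def, Fin.forall_fin_two]
    exact ⟨⟨h0.1, h1.1⟩, h0.2, h1.2⟩
  refine (measure_mono hsub).trans ?_
  rw [(PiLp.volume_preserving_ofLp (Fin 2)).measure_preimage measurableSet_Icc.nullMeasurableSet,
    Real.volume_Icc_pi, Fin.prod_univ_two, ← ENNReal.ofReal_mul (by simp; positivity)]
  refine ENNReal.ofReal_le_ofReal (le_of_eq ?_)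
  rcases hr.eq_or_lt with rfl | hr
  · simp [Real.zero_rpow h.pos_left.ne', Real.zero_rpow (add_pos h.pos_left h.pos_right).ne']
  · simp [Real.rpow_add hr]
    ring

theorem setLIntegral_le_sqrt (f : Plane → ℝ≥0∞) (hf : Measurable f) (s : Set Plane) :
    ∫⁻ p in s, f p ≤ (∫⁻ p, f p ^ 2) ^ (1 / 2 : ℝ) * volume s ^ (1 / 2 : ℝ) := by
  have := ENNReal.lintegral_mul_le_Lp_mul_Lq (volume.restrict s)
    (Real.HolderConjugate.two_two) hf.aemeasurable
    (aemeasurable_const (b := (1 : ℝ≥0∞)))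
  simp only [Pi.mul_apply, mul_one, one_pow, lintegral_const, one_mul,
    Measure.restrict_apply_univ, ENNReal.rpow_two, one_pow, one_mul] at this
  refine this.trans ?_
  gcongr
  exact Measure.restrict_le_self

/-- For fixed `q`, the frequency `p` ranges over a sublevel set of `M`. Cauchy–Schwarz there trades
`f p` for its `L²` norm and the square root of a small volume, which together with the weight makes
up one full power of `M q`. -/
theorem IsDissipative.lintegral_pair_le (h : IsDissipative M a b K) {c : ℝ} (hc : 0 < c)
    (hcab : 1 ≤ c + (a + b) / 2) {f : Plane → ℝ≥0∞} (hf : Measurable f) :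
    ∫⁻ q, ∫⁻ p, pairWeight M c p q * f p * f q ^ 2 ≤
      2 * (∫⁻ p, f p ^ 2) ^ (1 / 2 : ℝ) * ∫⁻ q, ENNReal.ofReal (M q) * f q ^ 2 := by
  rw [← lintegral_const_mul _ (by have := h.measurable; fun_prop)]
  refine lintegral_mono fun q => ?_
  rw [lintegral_mul_const _ (by
    have := (measurable_pairWeight h.measurable c).comp (measurable_id.prodMk measurable_const)
      (g := Function.uncurry (pairWeight M c)) (f := fun p => (p, q))
    exact this.mul hf), ← mul_assoc]
  gcongr
  set r := min (M q) 1 with hr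
  have hr0 : 0 ≤ r := le_min (h.nonneg q) zero_le_one
  have hr1 : r ≤ 1 := min_le_right _ _
  have hab : 0 < a + b := add_pos h.pos_left h.pos_right
  have hS : MeasurableSet {p | M p ≤ r} := measurableSet_le h.measurable measurable_const
  have e : (fun p => pairWeight M c p q * f p) =
      {p | M p ≤ r}.indicator fun p => ENNReal.ofReal (r ^ c) * f p := by
    ext p
    by_cases hp : M p ≤ r <;> simp [pairWeight, ← hr, hp]
  rw [e, lintegral_indicator hS, lintegral_const_mul _ hf]
  have hv : volume {p | M p ≤ r} ^ (1 / 2 : ℝ) ≤ ENNReal.ofReal (2 * r ^ ((a + b) / 2)) := by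
    refine (ENNReal.rpow_le_rpow (h.volume_le hr0) (by norm_num)).trans_eq ?_
    rw [ENNReal.ofReal_rpow_of_nonneg (by positivity) (by norm_num),
      Real.mul_rpow (by norm_num) (by positivity), ← Real.rpow_mul hr0, show (4 : ℝ) = 2 ^ (2 : ℝ) by
      norm_num, ← Real.rpow_mul (by norm_num)]
    norm_num
    ring_nf
  calc ENNReal.ofReal (r ^ c) * ∫⁻ p in {p | M p ≤ r}, f p
      ≤ ENNReal.ofReal (r ^ c) * ((∫⁻ p, f p ^ 2) ^ (1 / 2 : ℝ) *
        ENNReal.ofReal (2 * r ^ ((a + b) / 2))) := by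
        gcongr
        exact (setLIntegral_le_sqrt f hf _).trans (by gcongr)
    _ = (∫⁻ p, f p ^ 2) ^ (1 / 2 : ℝ) * ENNReal.ofReal (2 * r ^ (c + (a + b) / 2)) := by
        rw [mul_left_comm, ← ENNReal.ofReal_mul (by positivity),
          Real.rpow_add_of_nonneg hr0 hc.le (by positivity)]
        ring_nf
    _ ≤ (∫⁻ p, f p ^ 2) ^ (1 / 2 : ℝ) * ENNReal.ofReal (2 * M q) := by
        gcongr
        -- The scaling condition enters here: as `r ≤ 1`, an exponent of at least one suffices.
        calc r ^ (c + (a + b) / 2) ≤ r ^ (1 : ℝ) :=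
              Real.rpow_le_rpow_of_exponent_ge' hr0 hr1 zero_le_one hcab
          _ ≤ M q := by rw [Real.rpow_one]; exact min_le_left _ _
    _ = _ := by
        rw [ENNReal.ofReal_mul zero_le_two, ENNReal.ofReal_ofNat]
        ring

/-- The trilinear estimate: an interaction with output frequency in `{M ≤ 1}` is controlled by the
`L²` norm times the dissipation. -/
theorem IsDissipative.trilinear_le (h : IsDissipative M a b K) {c : ℝ} (hc : 0 < c)
    (hcab : 1 ≤ c + (a + b) / 2) {ω : Plane → ℝ} (hω : ∀ ξ, ω ξ ≤ M ξ ^ c)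
    {f : Plane → ℝ≥0∞} (hf : Measurable f) :
    ∫⁻ ξ in {ξ | M ξ ≤ 1}, ∫⁻ ζ, ENNReal.ofReal (ω ξ) * f ξ * f (ξ - ζ) * f ζ ≤
      ENNReal.ofReal (12 * max 1 (2 * K) ^ c) * (∫⁻ p, f p ^ 2) ^ (1 / 2 : ℝ) *
        ∫⁻ q, ENNReal.ofReal (M q) * f q ^ 2 := by
  set G : Plane → Plane → ℝ≥0∞ := fun p q => pairWeight M c p q * f p * f q ^ 2 with hG
  have hGm : Measurable (Function.uncurry G) :=
    ((measurable_pairWeight h.measurable c).mul (hf.comp measurable_fst)).mul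
      ((hf.comp measurable_snd).pow_const 2)
  have hm : ∀ u v : Plane × Plane → Plane, Measurable u → Measurable v →
      Measurable fun p => G (u p) (v p) := fun u v hu hv => hGm.comp (hu.prodMk hv)
  set J := ∫⁻ q, ∫⁻ p, G p q with hJ
  have hJle := h.lintegral_pair_le hc hcab hf
  -- Any two of `ξ`, `ζ`, `ξ - ζ` are coordinates on the product related by measure-preserving maps,
  -- so all six terms of `triple_le` integrate to `J`.
  have e1 : ∫⁻ ξ, ∫⁻ ζ, G ξ ζ = J := lintegral_lintegral_swap hGm.aemeasurable
  have e2 : ∫⁻ ξ, ∫⁻ ζ, G ξ (ξ - ζ) = J := by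
    rw [← e1]
    exact lintegral_congr fun ξ => lintegral_sub_left_eq_self (G ξ) ξ
  have e3 : ∫⁻ ξ, ∫⁻ ζ, G (ξ - ζ) ξ = J :=
    lintegral_congr fun ξ => lintegral_sub_left_eq_self (fun p => G p ξ) ξ
  have e4 : ∫⁻ ξ, ∫⁻ ζ, G (ξ - ζ) ζ = J := by
    rw [lintegral_lintegral_swap (f := fun ξ ζ => G (ξ - ζ) ζ)
      (hm (fun p => p.1 - p.2) (fun p => p.2) (by fun_prop) (by fun_prop)).aemeasurable]
    exact lintegral_congr fun ζ => lintegral_sub_right_eq_self (fun p => G p ζ) ζ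
  have e5 : ∫⁻ ξ, ∫⁻ ζ, G ζ (ξ - ζ) = J := by
    rw [← e4]
    refine lintegral_congr fun ξ => ?_
    rw [← lintegral_sub_left_eq_self _ ξ]
    simp only [sub_sub_cancel]
  set D := ENNReal.ofReal (max 1 (2 * K) ^ c) with hD
  have key : ∫⁻ ξ in {ξ | M ξ ≤ 1}, ∫⁻ ζ, ENNReal.ofReal (ω ξ) * f ξ * f (ξ - ζ) * f ζ ≤
      ∫⁻ ξ, ∫⁻ ζ, D * (G ξ (ξ - ζ) + G ξ ζ + G (ξ - ζ) ξ + G (ξ - ζ) ζ + G ζ ξ + G ζ (ξ - ζ)) := by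
    refine (setLIntegral_mono' (measurableSet_le h.measurable measurable_const) fun ξ hξ =>
      lintegral_mono fun ζ => ?_).trans (setLIntegral_le_lintegral _ _)
    exact h.triple_le hc hω f (sub_add_cancel ξ ζ).symm hξ
  refine key.trans ?_
  have m1 := hm (fun p => p.1) (fun p => p.1 - p.2) (by fun_prop) (by fun_prop)
  have m2 := hm (fun p => p.1) (fun p => p.2) (by fun_prop) (by fun_prop)
  have m3 := hm (fun p => p.1 - p.2) (fun p => p.1) (by fun_prop) (by fun_prop)
  have m4 := hm (fun p => p.1 - p.2) (fun p => p.2) (by fun_prop) (by fun_prop)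
  have m5 := hm (fun p => p.2) (fun p => p.1) (by fun_prop) (by fun_prop)
  have m6 := hm (fun p => p.2) (fun p => p.1 - p.2) (by fun_prop) (by fun_prop)
  simp only [lintegral_lintegral (f := fun ξ ζ => D * (G ξ (ξ - ζ) + G ξ ζ + G (ξ - ζ) ξ +
    G (ξ - ζ) ζ + G ζ ξ + G ζ (ξ - ζ))) ((((((m1.add m2).add m3).add m4).add m5).add
    m6).const_mul D).aemeasurable]
  rw [lintegral_const_mul D (by fun_prop),
    lintegral_add_right _ m6, lintegral_add_right _ m5, lintegral_add_right _ m4,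
    lintegral_add_right _ m3, lintegral_add_right _ m2]
  rw [lintegral_prod _ m1.aemeasurable, lintegral_prod _ m2.aemeasurable,
    lintegral_prod _ m3.aemeasurable, lintegral_prod _ m4.aemeasurable,
    lintegral_prod _ m5.aemeasurable, lintegral_prod _ m6.aemeasurable]
  rw [e1, e2, e3, e4, e5]
  change D * (J + J + J + J + J + J) ≤ _
  calc D * (J + J + J + J + J + J) = 6 * D * J := by ring
    _ ≤ 6 * D * (2 * (∫⁻ p, f p ^ 2) ^ (1 / 2 : ℝ) * ∫⁻ q, ENNReal.ofReal (M q) * f q ^ 2) := by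
        gcongr
    _ = _ := by
        rw [ENNReal.ofReal_mul (by norm_num), ENNReal.ofReal_ofNat, ← hD,
          show (12 : ℝ≥0∞) = 6 * 2 by norm_num]
        ring

end

end SQG

/-! ### The anisotropic and isotropic symbols are dissipative. -/

namespace SQG

theorem add_rpow_le_two_rpow {p u v : ℝ} (hp : 0 ≤ p) (hu : 0 ≤ u) (hv : 0 ≤ v) :
    (u + v) ^ p ≤ 2 ^ p * (u ^ p + v ^ p) := by
  have hup : 0 ≤ u ^ p := Real.rpow_nonneg hu p
  have hvp : 0 ≤ v ^ p := Real.rpow_nonneg hv p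
  rcases le_total u v with h | h
  · calc (u + v) ^ p ≤ (2 * v) ^ p := by gcongr; linarith
      _ = 2 ^ p * v ^ p := Real.mul_rpow (by norm_num) hv
      _ ≤ _ := by gcongr; linarith
  · calc (u + v) ^ p ≤ (2 * u) ^ p := by gcongr; linarith
      _ = 2 ^ p * u ^ p := Real.mul_rpow (by norm_num) hu
      _ ≤ _ := by gcongr; linarith

theorem freq_add (ξ η : Plane) : freq (ξ + η) = freq ξ + freq η := smul_add _ _ _

theorem freq_neg (ξ : Plane) : freq (-ξ) = -freq ξ := smul_neg _ _

theorem continuous_freq : Continuous freq := continuous_const_smul _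

theorem abs_apply_le_abs_freq (ξ : Plane) (j : Fin 2) : |ξ j| ≤ |freq ξ j| := by
  rw [freq, PiLp.smul_apply, smul_eq_mul, abs_mul]
  refine le_mul_of_one_le_left (abs_nonneg _) ?_
  rw [abs_of_nonneg Real.two_pi_pos.le]
  linarith [Real.pi_gt_three]

/-- Passing to the variable of Mathlib's transform keeps all constants, because the factor `2π` only
enlarges the coordinates. -/
theorem IsDissipative.comp_freq {m : Plane → ℝ} {a b K : ℝ} (h : IsDissipative m a b K) :
    IsDissipative (fun ξ => m (freq ξ)) a b K where
  measurable := h.measurable.comp continuous_freq.measurable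
  nonneg ξ := h.nonneg _
  even ξ := by rw [freq_neg, h.even]
  abs_zero_le ξ := (abs_apply_le_abs_freq ξ 0).trans (h.abs_zero_le _)
  abs_one_le ξ := (abs_apply_le_abs_freq ξ 1).trans (h.abs_one_le _)
  quasi_add ξ η := by rw [freq_add]; exact h.quasi_add _ _
  eventually_le_one := by
    have h0 : Tendsto freq (𝓝 0) (𝓝 0) := by
      have := continuous_freq.tendsto 0
      rwa [show freq 0 = 0 from smul_zero _] at this
    exact h0.eventually h.eventually_le_one
  pos_left := h.pos_left
  pos_right := h.pos_right
  two_le_left := h.two_le_left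
  two_le_right := h.two_le_right

theorem le_rpow_inv_of_rpow_le {p u v : ℝ} (hp : 0 < p) (hu : 0 ≤ u) (h : u ^ p ≤ v) :
    u ≤ v ^ p⁻¹ := by
  calc u = (u ^ p) ^ p⁻¹ := (Real.rpow_rpow_inv hu hp.ne').symm
    _ ≤ _ := by gcongr

/-- With `a = 1 / (2α)` and `b = 1 / (2β)`, the inequalities `2 ≤ 3a + b` and `2 ≤ a + 3b` are the
two halves of the hypothesis divided by `2αβ`. -/
theorem isDissipative_aniso {α β : ℝ} (hα : 0 < α) (hβ : 0 < β)
    (hαβ : 4 * α * β ≤ min (α + 3 * β) (3 * α + β)) :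
    IsDissipative (anisoSymbol α β) (2 * α)⁻¹ (2 * β)⁻¹ (2 ^ (2 * α) + 2 ^ (2 * β)) where
  measurable := aniso_measurable α β
  nonneg ξ := by unfold anisoSymbol; positivity
  even ξ := by simp [anisoSymbol]
  abs_zero_le ξ := le_rpow_inv_of_rpow_le (by positivity) (abs_nonneg _)
    (le_add_of_nonneg_right (by positivity))
  abs_one_le ξ := le_rpow_inv_of_rpow_le (by positivity) (abs_nonneg _)
    (le_add_of_nonneg_left (by positivity))
  quasi_add ξ η := by
    have key : ∀ (j : Fin 2) (p : ℝ), 0 < p →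
        |(ξ + η) j| ^ p ≤ 2 ^ p * (|ξ j| ^ p + |η j| ^ p) := fun j p hp =>
      (Real.rpow_le_rpow (abs_nonneg _) (abs_add_le _ _) hp.le).trans
        (add_rpow_le_two_rpow hp.le (abs_nonneg _) (abs_nonneg _))
    have h0 := key 0 (2 * α) (by positivity)
    have h1 := key 1 (2 * β) (by positivity)
    have p1 : 0 ≤ (2 : ℝ) ^ (2 * β) * (|ξ 0| ^ (2 * α) + |η 0| ^ (2 * α)) := by positivity
    have p2 : 0 ≤ (2 : ℝ) ^ (2 * α) * (|ξ 1| ^ (2 * β) + |η 1| ^ (2 * β)) := by positivity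
    unfold anisoSymbol
    linarith
  eventually_le_one := by
    have hc : Continuous (anisoSymbol α β) := by
      unfold anisoSymbol
      refine Continuous.add ?_ ?_ <;>
        exact Continuous.rpow_const (by fun_prop) fun _ => Or.inr (by positivity)
    have h0 : anisoSymbol α β 0 < 1 := by
      simp [anisoSymbol, Real.zero_rpow, hα.ne', hβ.ne']
    exact (hc.tendsto 0).eventually_le_const h0
  pos_left := by positivity
  pos_right := by positivity
  two_le_left := by
    have := hαβ.trans (min_le_left _ _)
    rw [show 3 * (2 * α)⁻¹ + (2 * β)⁻¹ = (α + 3 * β) / (2 * α * β) by field_simp; ring,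
      le_div_iff₀ (by positivity)]
    linarith
  two_le_right := by
    have := hαβ.trans (min_le_right _ _)
    rw [show (2 * α)⁻¹ + 3 * (2 * β)⁻¹ = (3 * α + β) / (2 * α * β) by field_simp; ring,
      le_div_iff₀ (by positivity)]
    linarith

theorem isDissipative_iso {α : ℝ} (hα : 0 < α) (hα1 : α ≤ 1) :
    IsDissipative (isoSymbol α) (2 * α)⁻¹ (2 * α)⁻¹ (2 ^ (2 * α)) where
  measurable := iso_measurable α
  nonneg ξ := by unfold isoSymbol; positivity
  even ξ := by simp [isoSymbol]
  abs_zero_le ξ := le_rpow_inv_of_rpow_le (by positivity) (abs_nonneg _)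
    (Real.rpow_le_rpow (abs_nonneg _) (PiLp.norm_apply_le ξ 0) (by positivity))
  abs_one_le ξ := le_rpow_inv_of_rpow_le (by positivity) (abs_nonneg _)
    (Real.rpow_le_rpow (abs_nonneg _) (PiLp.norm_apply_le ξ 1) (by positivity))
  quasi_add ξ η := (Real.rpow_le_rpow (norm_nonneg _) (norm_add_le _ _) (by positivity)).trans
    (add_rpow_le_two_rpow (by positivity) (norm_nonneg _) (norm_nonneg _))
  eventually_le_one := by
    have hc : Continuous (isoSymbol α) :=
      Continuous.rpow_const (by fun_prop) fun _ => Or.inr (by positivity)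
    have h0 : isoSymbol α 0 < 1 := by simp [isoSymbol, Real.zero_rpow, hα.ne']
    exact (hc.tendsto 0).eventually_le_const h0
  pos_left := by positivity
  pos_right := by positivity
  two_le_left := by
    have : 2⁻¹ ≤ (2 * α)⁻¹ := inv_anti₀ (by positivity) (by linarith)
    linarith
  two_le_right := by
    have : 2⁻¹ ≤ (2 * α)⁻¹ := inv_anti₀ (by positivity) (by linarith)
    linarith

end SQG

/-! ### Bilinear pairing, Fourier transform and reflection on `L²`. -/

namespace SQG

section Pairing

/-- The bilinear pairing `∫ f g`. -/
noncomputable def pair : L2C →L[ℂ] L2C →L[ℂ] ℂ :=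
  (ContinuousLinearMap.mul ℂ ℂ).lpPairing (volume : Measure Plane) 2 2

theorem pair_apply (f g : L2C) : pair f g = ∫ x, f x * g x :=
  ContinuousLinearMap.lpPairing_eq_integral _ f g

theorem pair_toLp_right (f : L2C) {g : Plane → ℂ} (hg : MemLp g 2 volume) :
    pair f (hg.toLp g) = ∫ x, f x * g x := by
  rw [pair_apply]
  refine integral_congr_ae ?_
  filter_upwards [hg.coeFn_toLp] with x hx
  rw [hx]

theorem pair_schwartz (f : L2C) (φ : 𝓢(Plane, ℂ)) : pair f (φ.toLp 2) = ∫ x, f x * φ x :=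
  pair_toLp_right f (φ.memLp 2)

/-- Multiplication of an `L²` function by a bounded one. -/
noncomputable def bddMul (φ : Lp ℂ ⊤ (volume : Measure Plane)) : L2C →L[ℂ] L2C :=
  (ContinuousLinearMap.mul ℂ ℂ).holderL volume ⊤ 2 2 φ

theorem coeFn_bddMul {φ : Plane → ℂ} (hφ : MemLp φ ⊤ (volume : Measure Plane)) (f : L2C) :
    bddMul (hφ.toLp φ) f =ᵐ[volume] fun x => φ x * f x := by
  refine ((ContinuousLinearMap.mul ℂ ℂ).coeFn_holder (r := 2) (hφ.toLp φ) f).trans ?_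
  filter_upwards [hφ.coeFn_toLp] with x hx
  simp [hx]

theorem dense_induction {p : L2C → Prop} (hc : IsClosed {f | p f})
    (h : ∀ φ : 𝓢(Plane, ℂ), p (φ.toLp 2)) (f : L2C) : p f :=
  DenseRange.induction_on (e := SchwartzMap.toLpCLM ℝ (E := Plane) ℂ 2 volume) (p := p)
    (SchwartzMap.denseRange_toLpCLM ENNReal.ofNat_ne_top) f hc h

theorem continuous_fourier_L2 : Continuous (fun f : L2C => (𝓕 f : L2C)) :=
  (Lp.fourierTransformₗᵢ Plane ℂ).continuous

theorem continuous_fourierInv_L2 : Continuous (fun f : L2C => (𝓕⁻ f : L2C)) :=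
  (Lp.fourierTransformₗᵢ Plane ℂ).symm.continuous

/-- The pairing has no conjugation, so the transform is symmetric for it; the Schwartz case extends
by density in each variable. -/
theorem pair_fourier (f g : L2C) : pair f (𝓕 g) = pair (𝓕 f) g := by
  have hF := continuous_fourier_L2
  refine dense_induction (p := fun f => pair f (𝓕 g) = pair (𝓕 f) g)
    (isClosed_eq (by fun_prop) (by fun_prop)) (fun φ => ?_) f
  refine dense_induction (p := fun g => pair (φ.toLp 2 volume : L2C) (𝓕 g : L2C) =
      pair (𝓕 (φ.toLp 2 volume : L2C) : L2C) g)
    (isClosed_eq (by fun_prop) (by fun_prop)) (fun ψ => ?_) g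
  rw [toLp_fourier_eq, toLp_fourier_eq, pair_schwartz, pair_schwartz]
  have e1 : ∫ x, (φ.toLp 2 (volume : Measure Plane)) x * (𝓕 ψ) x = ∫ x, φ x * (𝓕 ψ) x := by
    refine integral_congr_ae ?_
    filter_upwards [φ.coeFn_toLp 2 volume] with x hx
    rw [hx]
  have e2 : ∫ x, ((𝓕 φ).toLp 2 (volume : Measure Plane)) x * ψ x = ∫ x, (𝓕 φ) x * ψ x := by
    refine integral_congr_ae ?_
    filter_upwards [(𝓕 φ).coeFn_toLp 2 volume] with x hx
    rw [hx]
  rw [e1, e2, SchwartzMap.integral_fourier_mul_eq]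

/-- Reflection in the origin on `L²`. -/
noncomputable def reflect : L2C →ₗᵢ[ℂ] L2C :=
  Lp.compMeasurePreservingₗᵢ ℂ (fun x : Plane => -x) (Measure.measurePreserving_neg volume)

theorem coeFn_reflect (f : L2C) : reflect f =ᵐ[volume] fun x => f (-x) :=
  Lp.coeFn_compMeasurePreserving f (Measure.measurePreserving_neg volume)

theorem fourierInv_eq_reflect (f : L2C) : (𝓕⁻ f : L2C) = reflect (𝓕 f) := by
  have hF := continuous_fourier_L2
  have hI := continuous_fourierInv_L2
  have hR := reflect.continuous
  refine dense_induction (p := fun f => (𝓕⁻ f : L2C) = reflect (𝓕 f))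
    (isClosed_eq (by fun_prop) (by fun_prop)) (fun φ => ?_) f
  rw [toLp_fourier_eq, toLp_fourierInv_eq]
  refine Lp.ext ?_
  have h1 := (Measure.measurePreserving_neg (volume : Measure Plane)).quasiMeasurePreserving.ae_eq
    ((𝓕 φ).coeFn_toLp 2 volume)
  filter_upwards [coeFn_reflect ((𝓕 φ).toLp 2), (𝓕⁻ φ).coeFn_toLp 2 volume, h1] with x h2 h3 h4
  rw [h2, h3]
  simp only [Function.comp_def] at h4
  rw [h4, fourierInv_apply_eq]
  simp

theorem reflect_reflect (f : L2C) : reflect (reflect f) = f := by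
  refine Lp.ext ?_
  filter_upwards [coeFn_reflect (reflect f), (Measure.measurePreserving_neg
    (volume : Measure Plane)).quasiMeasurePreserving.ae_eq (coeFn_reflect f)] with x h1 h2
  simp only [Function.comp_def, neg_neg] at h2
  rw [h1, h2]

theorem fourierInv_reflect (f : L2C) : (𝓕⁻ (reflect f) : L2C) = 𝓕 f := by
  have h (g : L2C) : (𝓕⁻ (𝓕⁻ g : L2C) : L2C) = reflect g := by
    rw [fourierInv_eq_reflect, fourier_fourierInv_eq]
  rw [← h, fourierInv_eq_reflect, fourier_fourierInv_eq, fourierInv_eq_reflect, reflect_reflect]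

end Pairing

/-! ### Bilinear forms with a kernel dominated by an integrable function of the output frequency. -/

section Kernel

/-- Cauchy–Schwarz: the convolution of two `L²` functions is bounded, so a weight integrable in `ξ`
makes the double integral converge. -/
theorem lintegral_mul_sub_le (f g : L2C) (ξ : Plane) :
    ∫⁻ ζ, ‖f (ξ - ζ)‖ₑ * ‖g ζ‖ₑ ≤ ‖f‖ₑ * ‖g‖ₑ := by
  have hf := (Lp.stronglyMeasurable f).measurable.enorm
  have hg := (Lp.stronglyMeasurable g).measurable.enorm
  have := ENNReal.lintegral_mul_le_Lp_mul_Lq volume Real.HolderConjugate.two_two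
    (f := fun ζ => ‖f (ξ - ζ)‖ₑ) (g := fun ζ => ‖g ζ‖ₑ) (by fun_prop) hg.aemeasurable
  refine this.trans_eq ?_
  rw [lintegral_sub_left_eq_self (fun ζ => ‖f ζ‖ₑ ^ (2 : ℝ)) ξ, Lp.enorm_def, Lp.enorm_def,
    eLpNorm_eq_lintegral_rpow_enorm_toReal two_ne_zero ENNReal.ofNat_ne_top,
    eLpNorm_eq_lintegral_rpow_enorm_toReal two_ne_zero ENNReal.ofNat_ne_top]
  simp

/-- The bilinear form `∫∫ k(ξ, ζ) f(ξ - ζ) g(ζ)`. -/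
noncomputable def kernelForm (k : Plane × Plane → ℂ) (f g : Plane → ℂ) : ℂ :=
  ∫ p : Plane × Plane, k p * f (p.1 - p.2) * g p.2

variable {k : Plane × Plane → ℂ} {W : Plane → ℝ}

theorem lintegral_kernelForm_le (hk : ∀ p, ‖k p‖ ≤ W p.1) (hW : Integrable W) (f g : L2C) :
    ∫⁻ p : Plane × Plane, ‖k p * f (p.1 - p.2) * g p.2‖ₑ ≤
      ENNReal.ofReal ((∫ ξ, W ξ) * ‖f‖ * ‖g‖) := by
  have hf := (Lp.stronglyMeasurable f).measurable.enorm
  have hg := (Lp.stronglyMeasurable g).measurable.enorm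
  have hW0 : ∀ ξ, 0 ≤ W ξ := fun ξ => (norm_nonneg _).trans (hk (ξ, 0))
  have hWi : 0 ≤ ∫ ξ, W ξ := integral_nonneg hW0
  calc ∫⁻ p : Plane × Plane, ‖k p * f (p.1 - p.2) * g p.2‖ₑ
      ≤ ∫⁻ p : Plane × Plane, ENNReal.ofReal (W p.1) * (‖f (p.1 - p.2)‖ₑ * ‖g p.2‖ₑ) := by
        refine lintegral_mono fun p => ?_
        rw [enorm_mul, enorm_mul, mul_assoc]
        gcongr
        rw [← ofReal_norm]
        exact ENNReal.ofReal_le_ofReal (hk p)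
    _ = ∫⁻ ξ, ∫⁻ ζ, ENNReal.ofReal (W ξ) * (‖f (ξ - ζ)‖ₑ * ‖g ζ‖ₑ) := by
        refine lintegral_prod _ ?_
        refine AEMeasurable.mul (f := fun p : Plane × Plane => ENNReal.ofReal (W p.1))
          (g := fun p : Plane × Plane => ‖f (p.1 - p.2)‖ₑ * ‖g p.2‖ₑ) ?_ (by fun_prop)
        exact hW.aestronglyMeasurable.aemeasurable.ennreal_ofReal.comp_quasiMeasurePreserving
          Measure.quasiMeasurePreserving_fst
    _ ≤ ∫⁻ ξ, ENNReal.ofReal (W ξ) * (‖f‖ₑ * ‖g‖ₑ) := by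
        refine lintegral_mono fun ξ => ?_
        rw [lintegral_const_mul _ (by fun_prop)]
        gcongr
        exact lintegral_mul_sub_le f g ξ
    _ = _ := by
        rw [lintegral_mul_const'' _ hW.aestronglyMeasurable.aemeasurable.ennreal_ofReal,
          ← ofReal_integral_eq_lintegral_ofReal hW (ae_of_all _ hW0), ← ofReal_norm, ← ofReal_norm,
          ← ENNReal.ofReal_mul (norm_nonneg _), ← ENNReal.ofReal_mul hWi,
          mul_assoc]

theorem integrable_kernelForm (hkm : AEStronglyMeasurable k) (hk : ∀ p, ‖k p‖ ≤ W p.1)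
    (hW : Integrable W) (f g : L2C) :
    Integrable fun p : Plane × Plane => k p * f (p.1 - p.2) * g p.2 := by
  have hf := (Lp.stronglyMeasurable f).measurable
  have hg := (Lp.stronglyMeasurable g).measurable
  refine ⟨(hkm.mul ?_).mul ?_, (lintegral_kernelForm_le hk hW f g).trans_lt ENNReal.ofReal_lt_top⟩
  · exact Measurable.aestronglyMeasurable (by fun_prop)
  · exact Measurable.aestronglyMeasurable (by fun_prop)

theorem norm_kernelForm_le (hk : ∀ p, ‖k p‖ ≤ W p.1) (hW : Integrable W) (f g : L2C) :
    ‖kernelForm k f g‖ ≤ (∫ ξ, W ξ) * ‖f‖ * ‖g‖ := by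
  have hW0 : ∀ ξ, 0 ≤ W ξ := fun ξ => (norm_nonneg _).trans (hk (ξ, 0))
  have h := (enorm_integral_le_lintegral_enorm _).trans (lintegral_kernelForm_le hk hW f g)
  rw [← ofReal_norm, ENNReal.ofReal_le_ofReal_iff (by
    have hWi : 0 ≤ ∫ ξ, W ξ := integral_nonneg hW0
    positivity)] at h
  exact h

theorem ae_comp_sub {p : Plane → Prop} (h : ∀ᵐ x, p x) :
    ∀ᵐ q : Plane × Plane, p (q.1 - q.2) :=
  (quasiMeasurePreserving_sub_of_right_invariant (volume : Measure Plane) volume).ae h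

theorem ae_comp_snd {p : Plane → Prop} (h : ∀ᵐ x, p x) : ∀ᵐ q : Plane × Plane, p q.2 :=
  (Measure.quasiMeasurePreserving_snd (μ := (volume : Measure Plane)) (ν := volume)).ae h

/-- `kernelForm` as a continuous bilinear form on `L²`. -/
noncomputable def kernelFormL (k : Plane × Plane → ℂ) (W : Plane → ℝ)
    (hkm : AEStronglyMeasurable k) (hk : ∀ p, ‖k p‖ ≤ W p.1) (hW : Integrable W) :
    L2C →L[ℂ] L2C →L[ℂ] ℂ :=
  LinearMap.mkContinuous₂ (LinearMap.mk₂ ℂ (fun f g : L2C => kernelForm k f g)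
    (fun f f' g => by
      simp only [kernelForm]
      rw [← integral_add (integrable_kernelForm hkm hk hW f g)
        (integrable_kernelForm hkm hk hW f' g)]
      refine integral_congr_ae ?_
      filter_upwards [ae_comp_sub (Lp.coeFn_add f f')] with q hq
      rw [hq, Pi.add_apply]
      ring)
    (fun c f g => by
      simp only [kernelForm]
      rw [← integral_smul]
      refine integral_congr_ae ?_
      filter_upwards [ae_comp_sub (Lp.coeFn_smul c f)] with q hq
      rw [hq, Pi.smul_apply, smul_eq_mul, smul_eq_mul]
      ring)
    (fun f g g' => by
      simp only [kernelForm]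
      rw [← integral_add (integrable_kernelForm hkm hk hW f g)
        (integrable_kernelForm hkm hk hW f g')]
      refine integral_congr_ae ?_
      filter_upwards [ae_comp_snd (Lp.coeFn_add g g')] with q hq
      rw [hq, Pi.add_apply]
      ring)
    (fun c f g => by
      simp only [kernelForm]
      rw [← integral_smul]
      refine integral_congr_ae ?_
      filter_upwards [ae_comp_snd (Lp.coeFn_smul c g)] with q hq
      rw [hq, Pi.smul_apply, smul_eq_mul, smul_eq_mul]
      ring)) (∫ ξ, W ξ) (norm_kernelForm_le hk hW)

theorem kernelFormL_apply (hkm : AEStronglyMeasurable k) (hk : ∀ p, ‖k p‖ ≤ W p.1)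
    (hW : Integrable W) (f g : L2C) : kernelFormL k W hkm hk hW f g = kernelForm k f g := rfl

theorem kernelForm_congr {f f' g g' : Plane → ℂ} (hf : f =ᵐ[volume] f') (hg : g =ᵐ[volume] g') :
    kernelForm k f g = kernelForm k f' g' := by
  refine integral_congr_ae ?_
  filter_upwards [ae_comp_sub hf, ae_comp_snd hg] with q h1 h2
  rw [h1, h2]

end Kernel

end SQG

/-! ### The weak formulation on the Fourier side. -/

namespace SQG

open scoped Convolution

theorem integrable_mul_mul (f g : L2C) (φ : 𝓢(Plane, ℂ)) :
    Integrable fun x => f x * g x * φ x := by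
  have h : Integrable fun x => f x * g x := (Lp.memLp f).integrable_mul (Lp.memLp g)
  obtain ⟨C, -, hC⟩ := φ.decay 0 0
  exact h.mul_bdd (c := C) φ.continuous.aestronglyMeasurable (ae_of_all _ fun x => by simpa using hC x)

theorem integral_mul_mul_eq_pair (f g : L2C) (φ : 𝓢(Plane, ℂ)) :
    ∫ x, f x * g x * φ x = pair f (bddMul ((φ.memLp ⊤ volume).toLp φ) g) := by
  rw [pair_apply]
  refine integral_congr_ae ?_
  filter_upwards [coeFn_bddMul (φ.memLp ⊤ volume) g] with x hx
  rw [hx]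
  ring

/-- The convolution theorem for Schwartz functions, moved to the inverse transform by evaluating at
`-x`. -/
theorem integral_fourierInv_mul_fourierInv (F G ψ : 𝓢(Plane, ℂ)) :
    ∫ x, (𝓕⁻ F) x * (𝓕⁻ G) x * (𝓕 ψ) x = kernelForm (fun p => ψ p.1) F G := by
  have hint : Integrable (fun p : Plane × Plane => ψ p.1 * F (p.1 - p.2) * G p.2)
      (volume.prod volume) := by
    have h := integrable_kernelForm (k := fun p => ψ p.1) (W := fun ξ => ‖ψ ξ‖)
      (by have := ψ.continuous; exact Continuous.aestronglyMeasurable (by fun_prop))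
      (fun p => le_rfl) ψ.integrable.norm (F.toLp 2) (G.toLp 2)
    refine h.congr ?_
    filter_upwards [ae_comp_sub (F.coeFn_toLp 2 volume), ae_comp_snd (G.coeFn_toLp 2 volume)]
      with p h1 h2
    rw [h1, h2]
  set C := SchwartzMap.convolution (ContinuousLinearMap.mul ℂ ℂ) G F with hC
  have h1 : kernelForm (fun p => ψ p.1) F G = ∫ ξ, ψ ξ * C ξ := by
    rw [kernelForm, Measure.volume_eq_prod, integral_prod _ hint]
    refine integral_congr_ae (ae_of_all _ fun ξ => ?_)
    simp only [hC, SchwartzMap.convolution_apply, convolution_def, ContinuousLinearMap.mul_apply']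
    rw [← integral_const_mul]
    congr 1
    ext ζ
    ring
  have h2 : ∀ x, (𝓕⁻ C) x = (𝓕⁻ G) x * (𝓕⁻ F) x := by
    intro x
    have h3 : (𝓕 C) (-x) = (𝓕 G) (-x) * (𝓕 F) (-x) := by
      rw [hC, SchwartzMap.fourier_convolution]
      simp
    simpa [fourierInv_apply_eq] using h3
  rw [h1]
  have h4 := SchwartzMap.integral_fourierInv_mul_eq (𝓕 ψ) C
  rw [fourierInv_fourier_eq] at h4
  rw [h4]
  refine integral_congr_ae (ae_of_all _ fun x => ?_)
  simp only [h2]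
  ring

/-- The Fourier transform of a product of `L²` functions is the convolution of the Fourier
transforms, tested with a Schwartz function. -/
theorem integral_mul_mul_fourier (f g : L2C) (ψ : 𝓢(Plane, ℂ)) :
    ∫ x, f x * g x * (𝓕 ψ) x = kernelForm (fun p => ψ p.1) (𝓕 f : L2C) (𝓕 g : L2C) := by
  have hF := continuous_fourier_L2
  have hψ : AEStronglyMeasurable (fun p : Plane × Plane => ψ p.1) := by
    have := ψ.continuous
    exact Continuous.aestronglyMeasurable (by fun_prop)
  rw [integral_mul_mul_eq_pair, ← kernelFormL_apply (W := fun ξ => ‖ψ ξ‖) hψ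
    (fun p => le_rfl) ψ.integrable.norm]
  refine dense_induction (p := fun f => pair f _ = kernelFormL _ _ _ _ _ (𝓕 f : L2C) _)
    (isClosed_eq (by fun_prop) (by fun_prop)) (fun φ₁ => ?_) f
  refine dense_induction (p := fun g => pair _ (bddMul _ g) = kernelFormL _ _ _ _ _ _ (𝓕 g : L2C))
    (isClosed_eq (by fun_prop) (by fun_prop)) (fun φ₂ => ?_) g
  rw [← integral_mul_mul_eq_pair, kernelFormL_apply, toLp_fourier_eq, toLp_fourier_eq,
    kernelForm_congr ((𝓕 φ₁).coeFn_toLp 2 volume) ((𝓕 φ₂).coeFn_toLp 2 volume),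
    ← integral_fourierInv_mul_fourierInv, fourierInv_fourier_eq, fourierInv_fourier_eq]
  refine integral_congr_ae ?_
  filter_upwards [φ₁.coeFn_toLp 2 volume, φ₂.coeFn_toLp 2 volume] with x h1 h2
  rw [h1, h2]

theorem fourier_riesz (j : Fin 2) (f : L2C) :
    (𝓕 (riesz j f) : L2C) =ᵐ[volume] fun ξ => rieszSymbol j (freq ξ) * (𝓕 f : L2C) ξ := by
  rw [riesz, fourierMul, dif_pos (memLp_riesz j f), fourier_fourierInv_eq]
  exact (memLp_riesz j f).coeFn_toLp

theorem norm_rieszSymbol_le (j : Fin 2) (ξ : Plane) : ‖rieszSymbol j ξ‖ ≤ 1 := by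
  simp only [rieszSymbol, norm_div, norm_mul, Complex.norm_I, one_mul, Complex.norm_real, norm_norm]
  exact div_le_one_of_le₀ (PiLp.norm_apply_le ξ j) (norm_nonneg _)

/-- The symbol of the transport term: `ξ` is the output frequency and `ζ` is the frequency of the
velocity. -/
noncomputable def transportSymbol (p : Plane × Plane) : ℂ :=
  2 * Real.pi * Complex.I *
    (p.1 0 * rieszSymbol 1 (freq p.2) - p.1 1 * rieszSymbol 0 (freq p.2))

theorem measurable_transportSymbol : Measurable transportSymbol := by
  unfold transportSymbol rieszSymbol freq
  fun_prop

theorem norm_transportSymbol_le (p : Plane × Plane) :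
    ‖transportSymbol p‖ ≤ 2 * Real.pi * (|p.1 0| + |p.1 1|) := by
  rw [transportSymbol, norm_mul]
  have h1 : ‖(2 * Real.pi * Complex.I : ℂ)‖ = 2 * Real.pi := by
    simp [abs_of_pos Real.pi_pos]
  rw [h1]
  gcongr
  refine (norm_sub_le _ _).trans ?_
  rw [norm_mul, norm_mul, Complex.norm_real, Complex.norm_real, Real.norm_eq_abs, Real.norm_eq_abs]
  gcongr
  · exact mul_le_of_le_one_right (abs_nonneg _) (norm_rieszSymbol_le _ _)
  · exact mul_le_of_le_one_right (abs_nonneg _) (norm_rieszSymbol_le _ _)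

/-- The right-hand side of the equation on the Fourier side, tested with `ψ`. -/
noncomputable def weakRHS (M : Plane → ℝ) (ψ : Plane → ℂ) (f : Plane → ℂ) : ℂ :=
  kernelForm (fun p => transportSymbol p * ψ p.1) f f - ∫ ξ, f ξ * (M ξ * ψ ξ)

theorem coeFn_toComplex (θ : L2) : toComplex θ =ᵐ[volume] fun x => (θ x : ℂ) :=
  Complex.ofRealCLM.coeFn_compLp' θ

theorem integral_transport (θ : L2) (ψ : 𝓢(Plane, ℂ)) :
    ∫ x : Plane, (θ x : ℂ) *
      ∑ j : Fin 2, velocity θ j x * (∂_{EuclideanSpace.single j (1 : ℝ)} (𝓕 ψ)) x =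
    kernelForm (fun p => transportSymbol p * ψ p.1) (𝓕 (toComplex θ) : L2C)
      (𝓕 (toComplex θ) : L2C) := by
  set f := toComplex θ with hf
  -- The derivative `∂_j` of `𝓕 ψ` is the transform of `ψ' j`.
  set ψ' : Fin 2 → 𝓢(Plane, ℂ) := fun j => -(2 * Real.pi * Complex.I) •
    smulLeftCLM ℂ (inner ℝ · (EuclideanSpace.single j (1 : ℝ))) ψ with hψ'
  have hψ'_apply : ∀ j ξ, ψ' j ξ = -(2 * Real.pi * Complex.I) * (ξ j * ψ ξ) := by
    intro j ξ
    have ht : (fun ξ : Plane => inner ℝ ξ (EuclideanSpace.single j (1 : ℝ))).HasTemperateGrowth :=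
      by fun_prop
    have hi : inner ℝ ξ (EuclideanSpace.single j (1 : ℝ)) = ξ j :=
      (EuclideanSpace.inner_single_right j (1 : ℝ) ξ).trans (by simp)
    simp only [hψ', _root_.smul_apply, smulLeftCLM_apply_apply ht, hi, smul_eq_mul,
      Complex.real_smul]
  have hsplit : ∫ x : Plane, (θ x : ℂ) *
      ∑ j : Fin 2, velocity θ j x * (∂_{EuclideanSpace.single j (1 : ℝ)} (𝓕 ψ)) x =
      ∫ x, (f x * velocity θ 0 x * (𝓕 (ψ' 0)) x + f x * velocity θ 1 x * (𝓕 (ψ' 1)) x) := by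
    refine integral_congr_ae ?_
    filter_upwards [coeFn_toComplex θ] with x hx
    rw [hf, hx, Fin.sum_univ_two, SchwartzMap.lineDerivOp_fourier_eq,
      SchwartzMap.lineDerivOp_fourier_eq]
    ring
  rw [hsplit, integral_add (integrable_mul_mul _ _ _) (integrable_mul_mul _ _ _),
    integral_mul_mul_fourier, integral_mul_mul_fourier, kernelForm, kernelForm, kernelForm,
    ← integral_add]
  · refine integral_congr_ae ?_
    have h0 : (𝓕 (velocity θ 0) : L2C) =ᵐ[volume]
        fun ξ => -(rieszSymbol 1 (freq ξ) * (𝓕 f : L2C) ξ) := by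
      have : (𝓕 (velocity θ 0) : L2C) = -𝓕 (riesz 1 f) := by
        change (Lp.fourierTransformₗᵢ Plane ℂ) (-riesz 1 f) = -(Lp.fourierTransformₗᵢ Plane ℂ) _
        exact map_neg _ _
      rw [this]
      filter_upwards [Lp.coeFn_neg (𝓕 (riesz 1 f) : L2C), fourier_riesz 1 f] with ξ h1 h2
      rw [h1, Pi.neg_apply, h2]
    have h1 : (𝓕 (velocity θ 1) : L2C) =ᵐ[volume]
        fun ξ => rieszSymbol 0 (freq ξ) * (𝓕 f : L2C) ξ := fourier_riesz 0 f
    filter_upwards [ae_comp_snd h0, ae_comp_snd h1] with p h0 h1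
    rw [h0, h1, hψ'_apply, hψ'_apply, transportSymbol]
    ring
  all_goals
    refine integrable_kernelForm (W := fun ξ => ‖ψ' _ ξ‖) ?_ (fun p => le_rfl)
      (ψ' _).integrable.norm _ _
    exact ((ψ' _).continuous.comp continuous_fst).aestronglyMeasurable

/-- Applying `𝓕` twice reflects, and an even symbol commutes with reflection. Hence `dissOp m (𝓕 ψ)`
is the transform of the symbol times `ψ`, and `pair_fourier` moves the transform onto `θ`. -/
theorem integral_dissOp {m : Plane → ℝ} (hm : Measurable m) (heven : ∀ ξ, m (-ξ) = m ξ) {k : ℕ}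
    {C : ℝ} (hb : ∀ ξ, |m ξ| ≤ C * (1 + ‖ξ‖) ^ k) (θ : L2) (ψ : 𝓢(Plane, ℂ)) :
    ∫ x : Plane, (θ x : ℂ) * dissOp m (𝓕 ψ) x =
      ∫ ξ, (𝓕 (toComplex θ) : L2C) ξ * (m (freq ξ) * ψ ξ) := by
  have h := memLp_symbol hm k C hb (𝓕 ψ)
  have hψψ : ∀ ξ, (𝓕 (𝓕 ψ)) ξ = ψ (-ξ) := by
    intro ξ
    have h1 := SchwartzMap.fourierInv_apply_eq (𝓕 ψ)
    rw [fourierInv_fourier_eq] at h1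
    conv_rhs => rw [h1]
    simp
  have hae : (fun ξ : Plane => (m (freq ξ) : ℂ) *
      (𝓕 ((𝓕 ψ).toLp 2 (volume : Measure Plane)) : L2C) ξ) =ᵐ[volume]
      fun ξ => m (freq ξ) * ψ (-ξ) := by
    rw [toLp_fourier_eq]
    filter_upwards [(𝓕 (𝓕 ψ)).coeFn_toLp 2 volume] with ξ hξ
    rw [hξ, hψψ]
  have h' : MemLp (fun ξ => (m (freq ξ) : ℂ) * ψ ξ) 2 volume := by
    have h2 := ((memLp_congr_ae hae).1 h).comp_measurePreserving
      (Measure.measurePreserving_neg (volume : Measure Plane))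
    refine (memLp_congr_ae (ae_of_all _ fun ξ => ?_)).1 h2
    simp only [Function.comp_def, neg_neg, freq_neg, heven]
  have hrefl : h.toLp _ = reflect (h'.toLp _) := by
    refine Lp.ext ?_
    filter_upwards [h.coeFn_toLp, hae, coeFn_reflect (h'.toLp _),
      (Measure.measurePreserving_neg
        (volume : Measure Plane)).quasiMeasurePreserving.ae_eq h'.coeFn_toLp] with ξ h1 h2 h3 h4
    rw [h1, h2, h3]
    simp only [Function.comp_def] at h4
    rw [h4, freq_neg, heven]
  have hd : dissOp m (𝓕 ψ) = 𝓕 (h'.toLp _ : L2C) := by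
    rw [dissOp, fourierMul, dif_pos h, hrefl, fourierInv_reflect]
  rw [hd, ← pair_toLp_right _ h', ← pair_fourier, pair_apply]
  refine integral_congr_ae ?_
  filter_upwards [coeFn_toComplex θ] with x hx
  rw [hx]

theorem IsWeakSolution.fourier {m : Plane → ℝ} {θ₀ : L2} {θ : ℝ → L2}
    (h : IsWeakSolution m θ₀ θ) (hm : Measurable m) (heven : ∀ ξ, m (-ξ) = m ξ) {k : ℕ}
    {C : ℝ} (hb : ∀ ξ, |m ξ| ≤ C * (1 + ‖ξ‖) ^ k) (ψ : 𝓢(Plane, ℂ)) {t : ℝ} (ht : 0 ≤ t) :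
    pair (𝓕 (toComplex (θ t))) (ψ.toLp 2) - pair (𝓕 (toComplex θ₀)) (ψ.toLp 2) =
      ∫ τ in (0 : ℝ)..t, weakRHS (fun ξ => m (freq ξ)) ψ (𝓕 (toComplex (θ τ)) : L2C) := by
  have hw := h.weak_form (𝓕 ψ) t ht
  simp only [integral_transport, integral_dissOp hm heven hb] at hw
  have key : ∀ η : L2, pair (𝓕 (toComplex η)) (ψ.toLp 2) = ∫ x : Plane, (η x : ℂ) * (𝓕 ψ) x := by
    intro η
    rw [← pair_fourier, toLp_fourier_eq, pair_schwartz]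
    refine integral_congr_ae ?_
    filter_upwards [coeFn_toComplex η] with x hx
    rw [hx]
  rw [key, key, hw]
  rfl

end SQG

/-! ### Frequency cutoffs and continuity of the tested equation. -/

namespace SQG

section L2Facts

theorem norm_star_L2 (f : L2C) : ‖star f‖ = ‖f‖ := by
  rw [Lp.norm_def, Lp.norm_def, eLpNorm_congr_ae (Lp.coeFn_star f), eLpNorm_star]

theorem star_sub_L2 (f g : L2C) : star (f - g) = star f - star g := by
  refine Lp.ext ?_
  filter_upwards [Lp.coeFn_star (f - g), Lp.coeFn_sub f g, Lp.coeFn_sub (star f) (star g),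
    Lp.coeFn_star f, Lp.coeFn_star g] with x h1 h2 h3 h4 h5
  simp only [h1, Pi.star_apply, h2, h3, Pi.sub_apply, h4, h5, star_sub]

theorem pair_star (f g : L2C) : pair f (star g) = inner ℂ g f := by
  rw [pair_apply, L2.inner_def]
  refine integral_congr_ae ?_
  filter_upwards [Lp.coeFn_star g] with x hx
  rw [hx]
  simp [RCLike.inner_apply]

theorem enorm_sq_eq_lintegral (f : L2C) : ‖f‖ₑ ^ 2 = ∫⁻ x, ‖f x‖ₑ ^ 2 := by
  rw [Lp.enorm_def, eLpNorm_eq_lintegral_rpow_enorm_toReal two_ne_zero ENNReal.ofNat_ne_top,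
    ← ENNReal.rpow_natCast, ← ENNReal.rpow_mul]
  simp

theorem enorm_eq_lintegral (f : L2C) : ‖f‖ₑ = (∫⁻ x, ‖f x‖ₑ ^ 2) ^ (1 / 2 : ℝ) := by
  rw [← enorm_sq_eq_lintegral, ← ENNReal.rpow_natCast, ← ENNReal.rpow_mul]
  simp

theorem integral_norm_mul_norm_le (f g : L2C) : ∫ x, ‖f x‖ * ‖g x‖ ≤ ‖f‖ * ‖g‖ := by
  have hf := (Lp.stronglyMeasurable f).measurable
  have hg := (Lp.stronglyMeasurable g).measurable
  rw [integral_eq_lintegral_of_nonneg_ae (ae_of_all _ fun x => by positivity)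
    (Measurable.aestronglyMeasurable (by fun_prop))]
  refine ENNReal.toReal_le_of_le_ofReal (by positivity) ?_
  rw [ENNReal.ofReal_mul (norm_nonneg _), ofReal_norm, ofReal_norm]
  have := ENNReal.lintegral_mul_le_Lp_mul_Lq volume Real.HolderConjugate.two_two
    hf.enorm.aemeasurable hg.enorm.aemeasurable
  rw [enorm_eq_lintegral f, enorm_eq_lintegral g]
  simpa [ENNReal.ofReal_mul] using this

theorem norm_toComplex (θ : L2) : ‖toComplex θ‖ = ‖θ‖ := by
  rw [Lp.norm_def, Lp.norm_def]
  congr 1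
  refine eLpNorm_congr_norm_ae ?_
  filter_upwards [coeFn_toComplex θ] with x hx
  rw [hx, Complex.norm_real]

theorem norm_fourier_toComplex (θ : L2) : ‖(𝓕 (toComplex θ) : L2C)‖ = ‖θ‖ := by
  rw [Lp.norm_fourier_eq, norm_toComplex]

theorem continuous_fourier_toComplex : Continuous fun θ : L2 => (𝓕 (toComplex θ) : L2C) :=
  continuous_fourier_L2.comp (Complex.ofRealCLM.compLpL 2 volume).continuous

end L2Facts

/-- A smooth frequency cutoff to the region `{M ≤ 1}`. -/
structure IsCutoff (M χ : Plane → ℝ) : Prop where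
  contDiff : ContDiff ℝ (⊤ : ℕ∞) χ
  hasCompactSupport : HasCompactSupport χ
  nonneg : ∀ ξ, 0 ≤ χ ξ
  le_one : ∀ ξ, χ ξ ≤ 1
  symbol_le : ∀ ξ, χ ξ ≠ 0 → M ξ ≤ 1

section Cutoff

variable {M χ : Plane → ℝ} {a b K : ℝ}

theorem IsCutoff.continuous (hχ : IsCutoff M χ) : Continuous χ := hχ.contDiff.continuous

theorem IsCutoff.memLp_top (hχ : IsCutoff M χ) :
    MemLp (fun ξ => (χ ξ : ℂ)) ⊤ (volume : Measure Plane) := by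
  refine memLp_top_of_bound (C := 1) ?_ (ae_of_all _ fun ξ => ?_)
  · have := hχ.continuous
    exact Continuous.aestronglyMeasurable (by fun_prop)
  · rw [Complex.norm_real, Real.norm_of_nonneg (hχ.nonneg ξ)]
    exact hχ.le_one ξ

theorem IsCutoff.memLp_two (hχ : IsCutoff M χ) :
    MemLp (fun ξ => (χ ξ : ℂ)) 2 (volume : Measure Plane) := by
  have := hχ.continuous
  refine Continuous.memLp_of_hasCompactSupport (by fun_prop) ?_
  exact hχ.hasCompactSupport.comp_left (g := fun x : ℝ => (x : ℂ)) Complex.ofReal_zero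

/-- The frequency cutoff as an operator on `L²`. -/
noncomputable def IsCutoff.cut (hχ : IsCutoff M χ) : L2C →L[ℂ] L2C :=
  bddMul (hχ.memLp_top.toLp _)

theorem IsCutoff.coeFn_cut (hχ : IsCutoff M χ) (f : L2C) :
    hχ.cut f =ᵐ[volume] fun ξ => χ ξ * f ξ := coeFn_bddMul hχ.memLp_top f

theorem IsCutoff.hasTemperateGrowth (hχ : IsCutoff M χ) :
    (fun ξ => (χ ξ : ℂ)).HasTemperateGrowth := by
  have h := hχ.hasCompactSupport.hasTemperateGrowth hχ.contDiff
  fun_prop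

theorem IsCutoff.coe_smulLeft (hχ : IsCutoff M χ) (φ : 𝓢(Plane, ℂ)) :
    ⇑(smulLeftCLM ℂ (fun ξ => (χ ξ : ℂ)) φ) = fun ξ => χ ξ * φ ξ := by
  ext ξ
  rw [smulLeftCLM_apply_apply hχ.hasTemperateGrowth, smul_eq_mul]

theorem IsCutoff.pair_cut (hχ : IsCutoff M χ) (f : L2C) (φ : 𝓢(Plane, ℂ)) :
    pair (hχ.cut f) (φ.toLp 2) =
      pair f ((smulLeftCLM ℂ (fun ξ => (χ ξ : ℂ)) φ).toLp 2) := by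
  rw [pair_schwartz, pair_schwartz, hχ.coe_smulLeft]
  refine integral_congr_ae ?_
  filter_upwards [hχ.coeFn_cut f] with x hx
  rw [hx]
  ring

/-- Kernel of the transport term tested with the cutoff of `w`. -/
noncomputable def cutKernel (χ : Plane → ℝ) (w : Plane → ℂ) (p : Plane × Plane) : ℂ :=
  transportSymbol p * (χ p.1 * w p.1)

theorem norm_cutKernel_le (h : IsDissipative M a b K) (hχ : IsCutoff M χ) (w : Plane → ℂ)
    (p : Plane × Plane) :
    ‖cutKernel χ w p‖ ≤ 4 * Real.pi * (‖(χ p.1 : ℂ)‖ * ‖w p.1‖) := by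
  rw [cutKernel, norm_mul, norm_mul]
  by_cases hp : χ p.1 = 0
  · simp [hp]
  have hM := hχ.symbol_le _ hp
  have h0 : |p.1 0| ≤ 1 := (h.abs_zero_le _).trans
    (Real.rpow_le_one (h.nonneg _) hM h.pos_left.le)
  have h1 : |p.1 1| ≤ 1 := (h.abs_one_le _).trans
    (Real.rpow_le_one (h.nonneg _) hM h.pos_right.le)
  gcongr
  refine (norm_transportSymbol_le p).trans ?_
  nlinarith [Real.pi_pos]

theorem aestronglyMeasurable_cutKernel (hχ : IsCutoff M χ) (w : L2C) :
    AEStronglyMeasurable (cutKernel χ w) := by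
  have h1 := hχ.continuous.measurable
  have h2 := (Lp.stronglyMeasurable w).measurable
  have h3 := measurable_transportSymbol
  unfold cutKernel
  exact Measurable.aestronglyMeasurable (by fun_prop)

theorem IsCutoff.integrable_bound (hχ : IsCutoff M χ) (w : L2C) :
    Integrable fun ξ => 4 * Real.pi * (‖(χ ξ : ℂ)‖ * ‖w ξ‖) :=
  (hχ.memLp_two.norm.integrable_mul (Lp.memLp w).norm).const_mul _

theorem IsCutoff.integral_bound_le (hχ : IsCutoff M χ) (w : L2C) :
    ∫ ξ, 4 * Real.pi * (‖(χ ξ : ℂ)‖ * ‖w ξ‖) ≤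
      4 * Real.pi * ‖hχ.memLp_two.toLp (fun ξ => (χ ξ : ℂ))‖ * ‖w‖ := by
  rw [integral_const_mul, mul_assoc (4 * Real.pi)]
  refine mul_le_mul_of_nonneg_left ?_ (by positivity)
  refine le_trans (le_of_eq ?_) (integral_norm_mul_norm_le _ _)
  refine integral_congr_ae ?_
  filter_upwards [hχ.memLp_two.coeFn_toLp] with ξ hξ
  rw [hξ]

theorem IsCutoff.norm_symbol_mul_le (h : IsDissipative M a b K) (hχ : IsCutoff M χ) (ξ : Plane) :
    ‖(M ξ * χ ξ : ℂ)‖ ≤ 1 := by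
  rw [norm_mul, Complex.norm_real, Complex.norm_real, Real.norm_of_nonneg (h.nonneg ξ),
    Real.norm_of_nonneg (hχ.nonneg ξ)]
  by_cases hp : χ ξ = 0
  · simp [hp]
  · exact mul_le_one₀ (hχ.symbol_le ξ hp) (hχ.nonneg ξ) (hχ.le_one ξ)

theorem IsCutoff.memLp_symbol_mul (h : IsDissipative M a b K) (hχ : IsCutoff M χ) :
    MemLp (fun ξ => (M ξ * χ ξ : ℂ)) ⊤ (volume : Measure Plane) := by
  refine memLp_top_of_bound (C := 1) ?_ (ae_of_all _ fun ξ => hχ.norm_symbol_mul_le h ξ)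
  have h1 := hχ.continuous.measurable
  have h2 := h.measurable
  exact Measurable.aestronglyMeasurable (by fun_prop)

/-- The right-hand side of the equation tested with the cutoff of `w`, written with continuous
(multi)linear maps. -/
theorem weakRHS_cut_eq (h : IsDissipative M a b K) (hχ : IsCutoff M χ) (w f : L2C) :
    weakRHS M (fun ξ => χ ξ * w ξ) f =
      kernelFormL (cutKernel χ w) (fun ξ => 4 * Real.pi * (‖(χ ξ : ℂ)‖ * ‖w ξ‖))
        (aestronglyMeasurable_cutKernel hχ w) (norm_cutKernel_le h hχ w)
        (hχ.integrable_bound w) f f -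
      pair f (bddMul ((hχ.memLp_symbol_mul h).toLp _) w) := by
  rw [weakRHS, kernelFormL_apply, pair_apply]
  congr 1
  refine integral_congr_ae ?_
  filter_upwards [coeFn_bddMul (hχ.memLp_symbol_mul h) w] with ξ hξ
  rw [hξ]
  ring

theorem weakRHS_cut_sub (h : IsDissipative M a b K) (hχ : IsCutoff M χ) (w w' f : L2C) :
    weakRHS M (fun ξ => χ ξ * w ξ) f - weakRHS M (fun ξ => χ ξ * w' ξ) f =
      weakRHS M (fun ξ => χ ξ * (w - w' : L2C) ξ) f := by
  rw [weakRHS_cut_eq h hχ, weakRHS_cut_eq h hχ, weakRHS_cut_eq h hχ, map_sub, map_sub]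
  have hk : kernelForm (cutKernel χ w) f f - kernelForm (cutKernel χ w') f f =
      kernelForm (cutKernel χ (w - w' : L2C)) f f := by
    simp only [kernelForm]
    rw [← integral_sub (integrable_kernelForm (aestronglyMeasurable_cutKernel hχ w)
      (norm_cutKernel_le h hχ w) (hχ.integrable_bound w) f f)
      (integrable_kernelForm (aestronglyMeasurable_cutKernel hχ w')
      (norm_cutKernel_le h hχ w') (hχ.integrable_bound w') f f)]
    refine integral_congr_ae ?_
    filter_upwards [(Measure.quasiMeasurePreserving_fst (μ := (volume : Measure Plane))
      (ν := (volume : Measure Plane))).ae (Lp.coeFn_sub w w')] with p hp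
    simp only [cutKernel]
    rw [hp, Pi.sub_apply]
    ring
  simp only [kernelFormL_apply]
  rw [← hk]
  ring

theorem continuous_weakRHS_cut (h : IsDissipative M a b K) (hχ : IsCutoff M χ) (w : L2C) :
    Continuous fun f : L2C => weakRHS M (fun ξ => χ ξ * w ξ) f := by
  simp only [weakRHS_cut_eq h hχ]
  fun_prop

/-- The cutoff confines the test function to bounded frequencies, where both the transport and the
dissipation symbol are bounded. This `C` depends on `χ`; it serves only for regularity in time. -/
theorem exists_norm_weakRHS_cut_le (h : IsDissipative M a b K) (hχ : IsCutoff M χ) (B : ℝ) :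
    ∃ C, 0 ≤ C ∧ ∀ w f : L2C, ‖f‖ ≤ B → ‖weakRHS M (fun ξ => χ ξ * w ξ) f‖ ≤ C * ‖w‖ := by
  set X := ‖hχ.memLp_two.toLp (fun ξ => (χ ξ : ℂ))‖ with hX
  set Y := ‖bddMul ((hχ.memLp_symbol_mul h).toLp _)‖ with hY
  refine ⟨4 * Real.pi * X * |B| * |B| + ‖pair‖ * |B| * Y, by positivity, fun w f hf => ?_⟩
  have hf' : ‖f‖ ≤ |B| := hf.trans (le_abs_self B)
  rw [weakRHS_cut_eq h hχ]
  refine (norm_sub_le _ _).trans ?_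
  rw [add_mul]
  refine add_le_add ?_ ?_
  · rw [kernelFormL_apply]
    refine (norm_kernelForm_le (norm_cutKernel_le h hχ w) (hχ.integrable_bound w) f f).trans ?_
    calc _ ≤ 4 * Real.pi * X * ‖w‖ * |B| * |B| := by
          gcongr
          exact hχ.integral_bound_le w
      _ = _ := by ring
  · refine (pair.le_opNorm₂ _ _).trans ?_
    calc _ ≤ ‖pair‖ * |B| * (Y * ‖w‖) := by
          gcongr
          exact ContinuousLinearMap.le_opNorm _ _
      _ = _ := by ring

end Cutoff

end SQG

/-! ### The energy flux into low frequencies. -/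

namespace SQG

section Dissipation

variable {M χ : Plane → ℝ} {a b K : ℝ}

/-- The constant of the bound of the energy flux into low frequencies. -/
noncomputable def fluxConst (a b K : ℝ) : ℝ≥0∞ :=
  ENNReal.ofReal (4 * Real.pi) * (ENNReal.ofReal (12 * max 1 (2 * K) ^ a) +
    ENNReal.ofReal (12 * max 1 (2 * K) ^ b))

theorem fluxConst_ne_top : fluxConst a b K ≠ ⊤ := by
  unfold fluxConst
  finiteness

/-- The flux of energy into low frequencies is bounded by the dissipation. -/
theorem ofReal_re_weakRHS_le (h : IsDissipative M a b K) (hχ : IsCutoff M χ) (f : L2C) :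
    ENNReal.ofReal (weakRHS M (fun ξ => χ ξ * (star ((2 : ℂ) • hχ.cut f) : L2C) ξ) f).re ≤
      fluxConst a b K * ‖f‖ₑ * ∫⁻ ξ, ENNReal.ofReal (M ξ) * ‖f ξ‖ₑ ^ 2 := by
  have hw : (star ((2 : ℂ) • hχ.cut f) : L2C) =ᵐ[volume]
      fun ξ => 2 * (χ ξ * (starRingEnd ℂ) (f ξ)) := by
    filter_upwards [Lp.coeFn_star ((2 : ℂ) • hχ.cut f), Lp.coeFn_smul (2 : ℂ) (hχ.cut f),
      hχ.coeFn_cut f] with ξ h1 h2 h3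
    simp [h1, h2, h3]
  set w : L2C := star ((2 : ℂ) • hχ.cut f) with hwdef
  -- The dissipative term has a favourable sign and is dropped.
  have hdiss : 0 ≤ (∫ ξ, f ξ * (M ξ * (χ ξ * w ξ))).re := by
    have e : ∫ ξ, f ξ * (M ξ * (χ ξ * w ξ)) =
        ((∫ ξ, 2 * (M ξ * χ ξ ^ 2 * ‖f ξ‖ ^ 2) : ℝ) : ℂ) := by
      rw [← integral_complex_ofReal]
      refine integral_congr_ae ?_
      filter_upwards [hw] with ξ hξ
      rw [hξ]
      push_cast
      rw [← Complex.mul_conj']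
      ring
    rw [e, Complex.ofReal_re]
    refine integral_nonneg fun ξ => ?_
    have := h.nonneg ξ
    positivity
  have hre : (weakRHS M (fun ξ => χ ξ * w ξ) f).re ≤ ‖kernelForm (cutKernel χ w) f f‖ := by
    rw [weakRHS, Complex.sub_re]
    have := Complex.re_le_norm (kernelForm (cutKernel χ w) f f)
    unfold cutKernel at this ⊢
    linarith
  refine (ENNReal.ofReal_le_ofReal hre).trans ?_
  rw [ofReal_norm]
  refine (enorm_integral_le_lintegral_enorm _).trans ?_
  have hfm : Measurable fun ξ => ‖f ξ‖ₑ := (Lp.stronglyMeasurable f).measurable.enorm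
  set S : Set Plane := {ξ | M ξ ≤ 1} with hS
  have hSm : MeasurableSet S := measurableSet_le h.measurable measurable_const
  set T : Fin 2 → Plane → Plane → ℝ≥0∞ := fun j ξ ζ =>
    ENNReal.ofReal |ξ j| * ‖f ξ‖ₑ * ‖f (ξ - ζ)‖ₑ * ‖f ζ‖ₑ with hT
  have hTm : ∀ j, Measurable (Function.uncurry (T j)) := by
    intro j
    simp only [hT, Function.uncurry_def]
    fun_prop
  set P := ENNReal.ofReal (4 * Real.pi) with hP
  -- Only `χ ≤ 1` and the support in `{M ≤ 1}` are used, so the bound is independent of the cutoff.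
  -- The factor `4π` is `2π` from the derivative times the `2` in `w`.
  have hpt : ∀ᵐ p : Plane × Plane, ‖cutKernel χ w p * f (p.1 - p.2) * f p.2‖ₑ ≤
      S.indicator (fun ξ => P * (T 0 ξ p.2 + T 1 ξ p.2)) p.1 := by
    filter_upwards [(Measure.quasiMeasurePreserving_fst (μ := (volume : Measure Plane))
      (ν := (volume : Measure Plane))).ae hw] with p hp
    by_cases h0 : χ p.1 = 0
    · simp [cutKernel, h0]
    rw [Set.indicator_of_mem (show p.1 ∈ S from hχ.symbol_le _ h0), cutKernel, hp]
    have hχ1 : ‖(χ p.1 : ℂ)‖ ≤ 1 := by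
      rw [Complex.norm_real, Real.norm_of_nonneg (hχ.nonneg _)]
      exact hχ.le_one _
    have hk : ‖transportSymbol p * (χ p.1 * (2 * (χ p.1 * (starRingEnd ℂ) (f p.1))))‖ ≤
        4 * Real.pi * (|p.1 0| + |p.1 1|) * ‖f p.1‖ := by
      rw [norm_mul, norm_mul, norm_mul, norm_mul, RCLike.norm_conj]
      have h2 : ‖(2 : ℂ)‖ = 2 := by simp
      calc _ ≤ 2 * Real.pi * (|p.1 0| + |p.1 1|) * (1 * (2 * (1 * ‖f p.1‖))) := by
            rw [h2]
            gcongr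
            exact norm_transportSymbol_le p
        _ = _ := by ring
    rw [enorm_mul, enorm_mul]
    have hk' := ENNReal.ofReal_le_ofReal hk
    rw [ofReal_norm, ENNReal.ofReal_mul (by positivity), ENNReal.ofReal_mul (by positivity),
      ENNReal.ofReal_add (abs_nonneg _) (abs_nonneg _), ofReal_norm] at hk'
    calc _ ≤ _ := mul_le_mul_left (mul_le_mul_left hk' _) _
      _ = _ := by simp only [hT, hP]; ring
  refine (lintegral_mono_ae hpt).trans ?_
  have hind : Measurable fun p : Plane × Plane =>
      S.indicator (fun ξ => P * (T 0 ξ p.2 + T 1 ξ p.2)) p.1 := by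
    have : (fun p : Plane × Plane => S.indicator (fun ξ => P * (T 0 ξ p.2 + T 1 ξ p.2)) p.1) =
        (Prod.fst ⁻¹' S).indicator fun p : Plane × Plane =>
          P * (Function.uncurry (T 0) p + Function.uncurry (T 1) p) := rfl
    rw [this]
    exact (((hTm 0).add (hTm 1)).const_mul P).indicator (measurable_fst hSm)
  have hab0 : 1 ≤ a + (a + b) / 2 := by linarith [h.two_le_left]
  have hab1 : 1 ≤ b + (a + b) / 2 := by linarith [h.two_le_right]
  have t0 := h.trilinear_le h.pos_left hab0 h.abs_zero_le hfm
  have t1 := h.trilinear_le h.pos_right hab1 h.abs_one_le hfm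
  rw [← enorm_eq_lintegral] at t0 t1
  calc ∫⁻ p : Plane × Plane, S.indicator (fun ξ => P * (T 0 ξ p.2 + T 1 ξ p.2)) p.1
      = ∫⁻ ξ, ∫⁻ ζ, S.indicator (fun ξ => P * (T 0 ξ ζ + T 1 ξ ζ)) ξ :=
        lintegral_prod _ hind.aemeasurable
    _ = ∫⁻ ξ, S.indicator (fun ξ => P * (∫⁻ ζ, T 0 ξ ζ) + P * ∫⁻ ζ, T 1 ξ ζ) ξ := by
        refine lintegral_congr fun ξ => ?_
        by_cases hξ : ξ ∈ S
        · simp only [Set.indicator_of_mem hξ]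
          have m0 : Measurable (T 0 ξ) := (hTm 0).of_uncurry_left
          have m1 : Measurable (T 1 ξ) := (hTm 1).of_uncurry_left
          rw [lintegral_const_mul P (by fun_prop), lintegral_add_left m0, mul_add]
        · simp [Set.indicator_of_notMem hξ]
    _ = P * (∫⁻ ξ in S, ∫⁻ ζ, T 0 ξ ζ) + P * ∫⁻ ξ in S, ∫⁻ ζ, T 1 ξ ζ := by
        have m0 : Measurable fun ξ => ∫⁻ ζ, T 0 ξ ζ := (hTm 0).lintegral_prod_right'
        have m1 : Measurable fun ξ => ∫⁻ ζ, T 1 ξ ζ := (hTm 1).lintegral_prod_right'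
        rw [lintegral_indicator hSm, lintegral_add_left (m0.const_mul P),
          lintegral_const_mul _ m0, lintegral_const_mul _ m1]
    _ ≤ P * _ + P * _ := add_le_add (mul_le_mul_right t0 _) (mul_le_mul_right t1 _)
    _ = _ := by unfold fluxConst; ring

end Dissipation

end SQG

/-! ### The low-frequency energy over short time intervals. -/

namespace SQG

section LocalEnergy

theorem ofReal_integral_le_lintegral {α : Type*} [MeasurableSpace α] {μ : Measure α} {f : α → ℝ}
    (hf : Integrable f μ) : ENNReal.ofReal (∫ x, f x ∂μ) ≤ ∫⁻ x, ENNReal.ofReal (f x) ∂μ := by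
  rw [integral_eq_lintegral_pos_part_sub_lintegral_neg_part hf]
  exact (ENNReal.ofReal_le_ofReal (sub_le_self _ ENNReal.toReal_nonneg)).trans
    ENNReal.ofReal_toReal_le

theorem weakRHS_congr {M : Plane → ℝ} {ψ ψ' f : Plane → ℂ} (h : ψ =ᵐ[volume] ψ') :
    weakRHS M ψ f = weakRHS M ψ' f := by
  unfold weakRHS kernelForm
  congr 1
  · refine integral_congr_ae ?_
    filter_upwards [(Measure.quasiMeasurePreserving_fst (μ := (volume : Measure Plane))
      (ν := (volume : Measure Plane))).ae h] with p hp
    rw [hp]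
  · refine integral_congr_ae ?_
    filter_upwards [h] with ξ hξ
    rw [hξ]

/-- The set-up of the low-frequency energy estimate: a weak solution whose symbol is `M` in the
variable of Mathlib's Fourier transform. -/
structure IsDissipativeSolution (m : Plane → ℝ) (a b K : ℝ) (θ₀ : L2) (θ : ℝ → L2) : Prop where
  isWeakSolution : IsWeakSolution m θ₀ θ
  isDissipative : IsDissipative m a b K
  polynomial_growth : ∃ (k : ℕ) (C : ℝ), ∀ ξ, |m ξ| ≤ C * (1 + ‖ξ‖) ^ k

variable {m χ : Plane → ℝ} {a b K : ℝ} {θ₀ : L2} {θ : ℝ → L2}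

theorem IsWeakSolution.norm_le (h : IsWeakSolution m θ₀ θ) {t : ℝ} (ht : 0 ≤ t) :
    ‖θ t‖ ≤ ‖θ₀‖ := by
  have h1 := le_self_add.trans (h.energy_zero t ht)
  rw [ENNReal.ofReal_le_ofReal_iff (by positivity)] at h1
  exact le_of_sq_le_sq h1 (norm_nonneg _)

/-- The Fourier transform of the solution at time `t`. -/
noncomputable def hat (θ : ℝ → L2) (t : ℝ) : L2C := 𝓕 (toComplex (θ t))

theorem norm_hat (θ : ℝ → L2) (t : ℝ) : ‖hat θ t‖ = ‖θ t‖ := norm_fourier_toComplex _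

theorem IsDissipativeSolution.integrableOn (h : IsDissipativeSolution m a b K θ₀ θ)
    (hχ : IsCutoff (fun ξ => m (freq ξ)) χ) (w : L2C) {s t : ℝ} (hs : 0 ≤ s) :
    IntegrableOn (fun τ => weakRHS (fun ξ => m (freq ξ)) (fun ξ => χ ξ * w ξ) (hat θ τ))
      (Set.Ioc s t) := by
  have hM := h.isDissipative.comp_freq
  obtain ⟨C, -, hC⟩ := exists_norm_weakRHS_cut_le hM hχ ‖θ₀‖
  have hsub : Set.Ioc s t ⊆ Set.Ioi 0 := fun τ hτ => hs.trans_lt hτ.1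
  refine Integrable.of_bound (C := C * ‖w‖) ?_ ?_
  · have hc : Continuous fun η : L2 => weakRHS (fun ξ => m (freq ξ)) (fun ξ => χ ξ * w ξ)
        (𝓕 (toComplex η) : L2C) :=
      (continuous_weakRHS_cut hM hχ w).comp continuous_fourier_toComplex
    exact (hc.comp_aestronglyMeasurable h.isWeakSolution.aestronglyMeasurable).mono_set hsub
  · filter_upwards [ae_restrict_mem measurableSet_Ioc] with τ hτ
    exact hC w _ ((norm_hat θ τ).trans_le (h.isWeakSolution.norm_le (hsub hτ).le))

theorem IsDissipativeSolution.pair_cut_sub (h : IsDissipativeSolution m a b K θ₀ θ)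
    (hχ : IsCutoff (fun ξ => m (freq ξ)) χ) (φ : 𝓢(Plane, ℂ)) {s t : ℝ} (hs : 0 ≤ s)
    (hst : s ≤ t) :
    pair (hχ.cut (hat θ t) - hχ.cut (hat θ s)) (φ.toLp 2) =
      ∫ τ in Set.Ioc s t, weakRHS (fun ξ => m (freq ξ))
        (fun ξ => χ ξ * (φ.toLp 2 (volume : Measure Plane) : L2C) ξ) (hat θ τ) := by
  obtain ⟨k, C, hb⟩ := h.polynomial_growth
  have key : ∀ r : ℝ, 0 ≤ r → pair (hχ.cut (hat θ r)) (φ.toLp 2) -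
      pair (hχ.cut (𝓕 (toComplex θ₀))) (φ.toLp 2) =
      ∫ τ in (0 : ℝ)..r, weakRHS (fun ξ => m (freq ξ))
        (fun ξ => χ ξ * (φ.toLp 2 (volume : Measure Plane) : L2C) ξ) (hat θ τ) := by
    intro r hr
    rw [hχ.pair_cut, hχ.pair_cut]
    refine (h.isWeakSolution.fourier h.isDissipative.measurable h.isDissipative.even hb _ hr).trans
      ?_
    refine intervalIntegral.integral_congr fun τ _ => ?_
    refine weakRHS_congr ?_
    rw [hχ.coe_smulLeft]
    filter_upwards [φ.coeFn_toLp 2 volume] with ξ hξ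
    rw [hξ]
  have hint : ∀ r : ℝ, 0 ≤ r → IntervalIntegrable (fun τ => weakRHS (fun ξ => m (freq ξ))
      (fun ξ => χ ξ * (φ.toLp 2 (volume : Measure Plane) : L2C) ξ) (hat θ τ)) volume 0 r :=
    fun r hr => (intervalIntegrable_iff_integrableOn_Ioc_of_le hr).2
      (h.integrableOn hχ _ le_rfl)
  rw [map_sub, _root_.sub_apply, ← intervalIntegral.integral_of_le hst,
    ← intervalIntegral.integral_interval_sub_left (hint t (hs.trans hst)) (hint s hs),
    ← key t (hs.trans hst), ← key s hs]
  ring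

/-- Duality: by density `star v` is an admissible test function, and it returns `‖v‖ ^ 2`. -/
theorem norm_le_of_forall_pair_le {v : L2C} {C : ℝ} (hC : 0 ≤ C)
    (h : ∀ φ : 𝓢(Plane, ℂ), ‖pair v (φ.toLp 2)‖ ≤ C * ‖(φ.toLp 2 volume : L2C)‖) : ‖v‖ ≤ C := by
  have h1 : ‖pair v (star v)‖ ≤ C * ‖star v‖ :=
    dense_induction (p := fun w => ‖pair v w‖ ≤ C * ‖w‖)
      (isClosed_le (by fun_prop) (by fun_prop)) h (star v)
  rw [pair_star, inner_self_eq_norm_sq_to_K, norm_star_L2] at h1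
  have h2 : ‖v‖ * ‖v‖ ≤ C * ‖v‖ := by
    simpa [sq] using h1
  rcases (norm_nonneg v).eq_or_lt with hv | hv
  · rw [← hv]; exact hC
  · exact le_of_mul_le_mul_right h2 hv

theorem IsDissipativeSolution.exists_lipschitz (h : IsDissipativeSolution m a b K θ₀ θ)
    (hχ : IsCutoff (fun ξ => m (freq ξ)) χ) : ∃ C, 0 ≤ C ∧
      (∀ (w : L2C) (τ : ℝ), 0 ≤ τ → ‖weakRHS (fun ξ => m (freq ξ)) (fun ξ => χ ξ * w ξ)
        (hat θ τ)‖ ≤ C * ‖w‖) ∧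
      ∀ s t : ℝ, 0 ≤ s → s ≤ t → ‖hχ.cut (hat θ t) - hχ.cut (hat θ s)‖ ≤ C * (t - s) := by
  obtain ⟨C, hC0, hC⟩ := exists_norm_weakRHS_cut_le h.isDissipative.comp_freq hχ ‖θ₀‖
  have hC' : ∀ (w : L2C) (τ : ℝ), 0 ≤ τ → ‖weakRHS (fun ξ => m (freq ξ)) (fun ξ => χ ξ * w ξ)
      (hat θ τ)‖ ≤ C * ‖w‖ := fun w τ hτ =>
    hC w _ ((norm_hat θ τ).trans_le (h.isWeakSolution.norm_le hτ))
  refine ⟨C, hC0, hC', fun s t hs hst => ?_⟩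
  refine norm_le_of_forall_pair_le (mul_nonneg hC0 (sub_nonneg.2 hst)) fun φ => ?_
  rw [h.pair_cut_sub hχ φ hs hst]
  refine (norm_setIntegral_le_of_norm_le_const (C := C * ‖(φ.toLp 2 volume : L2C)‖)
    (by simp) fun τ hτ => hC' _ τ (hs.trans hτ.1.le)).trans_eq ?_
  rw [Measure.real, Real.volume_Ioc, ENNReal.toReal_ofReal (sub_nonneg.2 hst)]
  ring

theorem re_inner_add_sub (v w : L2C) :
    (inner ℂ (v + w) (v - w) : ℂ).re = ‖v‖ ^ 2 - ‖w‖ ^ 2 := by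
  have h1 : (inner ℂ v w : ℂ).re = (inner ℂ w v : ℂ).re := inner_re_symm (𝕜 := ℂ) v w
  have h2 : (inner ℂ v v : ℂ).re = ‖v‖ ^ 2 := (norm_sq_eq_re_inner (𝕜 := ℂ) v).symm
  have h3 : (inner ℂ w w : ℂ).re = ‖w‖ ^ 2 := (norm_sq_eq_re_inner (𝕜 := ℂ) w).symm
  rw [inner_add_left, inner_sub_right, inner_sub_right]
  simp only [Complex.add_re, Complex.sub_re]
  linarith

theorem lintegral_hat_eq_dissipation (m : Plane → ℝ) (θ : ℝ → L2) (τ : ℝ) :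
    ∫⁻ ξ, ENNReal.ofReal (m (freq ξ)) * ‖hat θ τ ξ‖ₑ ^ 2 = dissipation m (θ τ) := rfl

/-- The energy inequality for low frequencies, up to an error of second order in the length of the
time interval. -/
theorem IsDissipativeSolution.exists_cut_energy_le (h : IsDissipativeSolution m a b K θ₀ θ)
    (hχ : IsCutoff (fun ξ => m (freq ξ)) χ) : ∃ C : ℝ, 0 ≤ C ∧ ∀ s t : ℝ, 0 ≤ s → s ≤ t →
      ENNReal.ofReal (‖hχ.cut (hat θ t)‖ ^ 2 - ‖hχ.cut (hat θ s)‖ ^ 2) ≤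
        (∫⁻ τ in Set.Ioc s t, fluxConst a b K * ‖θ₀‖ₑ * dissipation m (θ τ)) +
          ENNReal.ofReal (C * (t - s) ^ 2) := by
  obtain ⟨C, hC0, hC, hL⟩ := h.exists_lipschitz hχ
  -- One factor `C` bounds the tested equation; `2 * C` comes from the Lipschitz bound for the
  -- change of test function, with room to spare.
  refine ⟨2 * C * C, by positivity, fun s t hs hst => ?_⟩
  set V : ℝ → L2C := fun τ => hχ.cut (hat θ τ) with hV
  set I := ∫⁻ τ in Set.Ioc s t, fluxConst a b K * ‖θ₀‖ₑ * dissipation m (θ τ) with hI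
  set w₀ : L2C := star (V t + V s) with hw₀
  -- Testing `V t - V s` with `w₀` gives the difference of squared norms. Inside the time integral
  -- `w₀` is exchanged for `star (2 • V τ)`, to which the flux bound applies. Schwartz functions
  -- approximate `w₀`, so their distance to it is carried along.
  have key : ∀ φ : 𝓢(Plane, ℂ), ENNReal.ofReal (pair (V t - V s) (φ.toLp 2)).re ≤
      I + ENNReal.ofReal (C * (‖(φ.toLp 2 volume : L2C) - w₀‖ + 2 * C * (t - s)) * (t - s)) := by
    intro φ
    set w : L2C := φ.toLp 2 volume with hw
    have hint := h.integrableOn hχ w (t := t) hs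
    rw [h.pair_cut_sub hχ φ hs hst, ← RCLike.re_eq_complex_re, ← integral_re hint]
    have hpt : ∀ τ ∈ Set.Ioc s t, ENNReal.ofReal (RCLike.re (weakRHS (fun ξ => m (freq ξ))
        (fun ξ => χ ξ * w ξ) (hat θ τ))) ≤
        fluxConst a b K * ‖θ₀‖ₑ * dissipation m (θ τ) +
          ENNReal.ofReal (C * (‖w - w₀‖ + 2 * C * (t - s))) := by
      intro τ hτ
      have hτ0 : 0 ≤ τ := hs.trans hτ.1.le
      set w₁ : L2C := star ((2 : ℂ) • V τ) with hw₁
      have hsub := weakRHS_cut_sub h.isDissipative.comp_freq hχ w w₁ (hat θ τ)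
      have hdist : ‖w - w₁‖ ≤ ‖w - w₀‖ + 2 * C * (t - s) := by
        have e : w₀ - w₁ = star ((V t - V τ) - (V τ - V s)) := by
          rw [hw₀, hw₁, ← star_sub_L2]
          congr 1
          rw [two_smul]
          abel
        have h1 : ‖w₀ - w₁‖ ≤ C * (t - τ) + C * (τ - s) := by
          rw [e, norm_star_L2]
          exact (norm_sub_le _ _).trans (add_le_add (hL τ t hτ0 hτ.2) (hL s τ hs hτ.1.le))
        have h2 := norm_sub_le_norm_sub_add_norm_sub w w₀ w₁
        have h3 : 0 ≤ C * (t - s) := mul_nonneg hC0 (sub_nonneg.2 hst)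
        linarith
      have hre : RCLike.re (weakRHS (fun ξ => m (freq ξ)) (fun ξ => χ ξ * w ξ) (hat θ τ)) ≤
          (weakRHS (fun ξ => m (freq ξ)) (fun ξ => χ ξ * w₁ ξ) (hat θ τ)).re +
            C * (‖w - w₀‖ + 2 * C * (t - s)) := by
        have h1 := (Complex.re_le_norm _).trans (hC (w - w₁) τ hτ0)
        rw [← hsub, Complex.sub_re] at h1
        have h2 := mul_le_mul_of_nonneg_left hdist hC0
        rw [RCLike.re_eq_complex_re]
        linarith
      refine (ENNReal.ofReal_le_ofReal hre).trans (ENNReal.ofReal_add_le.trans ?_)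
      gcongr
      refine (ofReal_re_weakRHS_le h.isDissipative.comp_freq hχ (hat θ τ)).trans ?_
      rw [lintegral_hat_eq_dissipation]
      gcongr
      rw [← ofReal_norm, ← ofReal_norm, norm_hat]
      exact ENNReal.ofReal_le_ofReal (h.isWeakSolution.norm_le hτ0)
    calc _ ≤ ∫⁻ τ in Set.Ioc s t, ENNReal.ofReal (RCLike.re (weakRHS (fun ξ => m (freq ξ))
          (fun ξ => χ ξ * w ξ) (hat θ τ))) := by
          exact ofReal_integral_le_lintegral hint.re
      _ ≤ ∫⁻ τ in Set.Ioc s t, (fluxConst a b K * ‖θ₀‖ₑ * dissipation m (θ τ) +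
          ENNReal.ofReal (C * (‖w - w₀‖ + 2 * C * (t - s)))) :=
          setLIntegral_mono' measurableSet_Ioc hpt
      _ = _ := by
          rw [lintegral_add_right _ measurable_const, setLIntegral_const, Real.volume_Ioc,
            ← ENNReal.ofReal_mul]
          have : 0 ≤ t - s := sub_nonneg.2 hst
          positivity
  have hfin := dense_induction (p := fun w : L2C => ENNReal.ofReal (pair (V t - V s) w).re ≤
      I + ENNReal.ofReal (C * (‖w - w₀‖ + 2 * C * (t - s)) * (t - s)))
    (isClosed_le (ENNReal.continuous_ofReal.comp (by fun_prop))
      ((ENNReal.continuous_ofReal.comp (by fun_prop)).const_add I)) key w₀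
  rw [hw₀, pair_star, re_inner_add_sub, sub_self, norm_zero, zero_add] at hfin
  convert hfin using 3
  ring

end LocalEnergy

end SQG

/-! ### Summation over time steps, small tails, and the choice of cutoffs. -/

namespace SQG

theorem setLIntegral_Ioc_add (g : ℝ → ℝ≥0∞) {r s t : ℝ} (hrs : r ≤ s) (hst : s ≤ t) :
    ∫⁻ τ in Set.Ioc r t, g τ = (∫⁻ τ in Set.Ioc r s, g τ) + ∫⁻ τ in Set.Ioc s t, g τ := by
  rw [← Set.Ioc_union_Ioc_eq_Ioc hrs hst,
    lintegral_union measurableSet_Ioc (Set.Ioc_disjoint_Ioc_of_le le_rfl)]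

/-- A quantity whose increments are bounded by an integral up to a quadratic error has increments
bounded by the integral. -/
theorem ofReal_sub_le_of_local {E : ℝ → ℝ} {g : ℝ → ℝ≥0∞} {C s t : ℝ} (hC : 0 ≤ C) (hst : s ≤ t)
    (h : ∀ s' t' : ℝ, s ≤ s' → s' ≤ t' → ENNReal.ofReal (E t' - E s') ≤
      (∫⁻ τ in Set.Ioc s' t', g τ) + ENNReal.ofReal (C * (t' - s') ^ 2)) :
    ENNReal.ofReal (E t - E s) ≤ ∫⁻ τ in Set.Ioc s t, g τ := by
  have step : ∀ (d : ℝ), 0 ≤ d → ∀ n : ℕ, ENNReal.ofReal (E (s + n * d) - E s) ≤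
      (∫⁻ τ in Set.Ioc s (s + n * d), g τ) + ENNReal.ofReal (n * (C * d ^ 2)) := by
    intro d hd n
    induction n with
    | zero => simp
    | succ n ih =>
      have h1 : s ≤ s + n * d := le_add_of_nonneg_right (by positivity)
      have h2 : s + n * d ≤ s + (n + 1 : ℕ) * d := by push_cast; linarith
      have h3 := h _ _ h1 h2
      rw [show s + (n + 1 : ℕ) * d - (s + n * d) = d by push_cast; ring] at h3
      calc _ = ENNReal.ofReal ((E (s + n * d) - E s) +
            (E (s + (n + 1 : ℕ) * d) - E (s + n * d))) := by ring_nf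
        _ ≤ _ := ENNReal.ofReal_add_le
        _ ≤ _ := add_le_add ih h3
        _ = _ := by
          rw [setLIntegral_Ioc_add g h1 h2, show ((n + 1 : ℕ) : ℝ) * (C * d ^ 2) =
            n * (C * d ^ 2) + C * d ^ 2 by push_cast; ring,
            ENNReal.ofReal_add (by positivity) (by positivity)]
          ring
  have hn : ∀ n : ℕ, ENNReal.ofReal (E t - E s) ≤ (∫⁻ τ in Set.Ioc s t, g τ) +
      ENNReal.ofReal (C * (t - s) ^ 2 * (1 / ((n : ℝ) + 1))) := by
    -- With `n + 1` equal steps the quadratic errors add up to `C (t - s) ^ 2 / (n + 1)`.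
    intro n
    have h0 : ((n + 1 : ℕ) : ℝ) ≠ 0 := by positivity
    have h1 := step ((t - s) / (n + 1 : ℕ)) (div_nonneg (sub_nonneg.2 hst) (by positivity)) (n + 1)
    rw [mul_div_cancel₀ _ h0, add_sub_cancel] at h1
    convert h1 using 3
    push_cast at h0 ⊢
    field_simp
  have hlim : Tendsto (fun n : ℕ => (∫⁻ τ in Set.Ioc s t, g τ) +
      ENNReal.ofReal (C * (t - s) ^ 2 * (1 / ((n : ℝ) + 1)))) atTop
      (𝓝 ((∫⁻ τ in Set.Ioc s t, g τ) + ENNReal.ofReal (C * (t - s) ^ 2 * 0))) :=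
    (ENNReal.tendsto_ofReal (tendsto_one_div_add_atTop_nhds_zero_nat.const_mul _)).const_add _
  rw [mul_zero, ENNReal.ofReal_zero, add_zero] at hlim
  exact ge_of_tendsto' hlim hn

/-- A function with bounded integrals over `(0, t]` has small tails. -/
theorem exists_tail_le {g : ℝ → ℝ≥0∞} {B : ℝ≥0∞} (hB : B ≠ ⊤)
    (hg : ∀ t, 0 ≤ t → ∫⁻ τ in Set.Ioc 0 t, g τ ≤ B) {δ : ℝ≥0∞} (hδ : δ ≠ 0) (s : ℝ) :
    ∃ r, 0 ≤ r ∧ s ≤ r ∧ ∀ t, r ≤ t → ∫⁻ τ in Set.Ioc r t, g τ ≤ δ := by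
  have hmono : Monotone fun t => ∫⁻ τ in Set.Ioc 0 t, g τ := fun t t' h =>
    lintegral_mono_set (Set.Ioc_subset_Ioc_right h)
  set S := ⨆ t : ℝ, ∫⁻ τ in Set.Ioc 0 t, g τ with hS
  have hSB : S ≤ B := iSup_le fun t => (hmono (le_max_left t 0)).trans (hg _ (le_max_right _ _))
  have hSt : S ≠ ⊤ := ne_top_of_le_ne_top hB hSB
  -- The supremum of the partial integrals is nearly attained. If it vanishes, `S - δ < S` fails and
  -- any `r₀` will do.
  obtain ⟨r₀, hr₀⟩ : ∃ r₀, S ≤ (∫⁻ τ in Set.Ioc 0 r₀, g τ) + δ := by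
    rcases eq_or_ne S 0 with h0 | h0
    · exact ⟨0, by simp [h0]⟩
    · obtain ⟨r₀, hr₀⟩ := lt_iSup_iff.1 (ENNReal.sub_lt_self hSt h0 hδ)
      exact ⟨r₀, tsub_le_iff_right.1 hr₀.le⟩
  refine ⟨max r₀ (max 0 s), by simp, by simp, fun t ht => ?_⟩
  set r := max r₀ (max 0 s)
  have hr : 0 ≤ r := le_max_of_le_right (le_max_left _ _)
  have h1 : (∫⁻ τ in Set.Ioc 0 r, g τ) + ∫⁻ τ in Set.Ioc r t, g τ ≤
      (∫⁻ τ in Set.Ioc 0 r, g τ) + δ := by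
    rw [← setLIntegral_Ioc_add g hr ht]
    exact (le_iSup (fun t => ∫⁻ τ in Set.Ioc 0 t, g τ) t).trans
      (hr₀.trans (add_le_add_left (hmono (le_max_left _ _)) δ))
  exact (ENNReal.add_le_add_iff_left (ne_top_of_le_ne_top hB (hg r hr))).1 h1

section Cutoff

variable {M : Plane → ℝ} {a b K : ℝ}

/-- A small value of `M` forces both coordinates to be small, since `‖ξ‖ ≤ |ξ 0| + |ξ 1| ≤ M ξ ^ a +
M ξ ^ b`. -/
theorem IsDissipative.exists_pos_le_symbol (h : IsDissipative M a b K) {ε : ℝ} (hε : 0 < ε) :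
    ∃ c, 0 < c ∧ ∀ ξ, ε ≤ ‖ξ‖ → c ≤ M ξ := by
  have hlim : Tendsto (fun c : ℝ => c ^ a + c ^ b) (𝓝 0) (𝓝 0) := by
    have hc : Continuous fun c : ℝ => c ^ a + c ^ b :=
      (continuous_id.rpow_const fun _ => Or.inr h.pos_left.le).add
        (continuous_id.rpow_const fun _ => Or.inr h.pos_right.le)
    simpa [Real.zero_rpow h.pos_left.ne', Real.zero_rpow h.pos_right.ne'] using hc.tendsto 0
  have hev : ∀ᶠ c in 𝓝[>] (0 : ℝ), c ^ a + c ^ b < ε ∧ 0 < c :=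
    ((hlim.eventually_lt_const hε).filter_mono nhdsWithin_le_nhds).and self_mem_nhdsWithin
  obtain ⟨c, hc, hc0⟩ := hev.exists
  refine ⟨c, hc0, fun ξ hξ => ?_⟩
  by_contra! hlt
  have h0 : |ξ 0| ≤ c ^ a := (h.abs_zero_le ξ).trans
    (Real.rpow_le_rpow (h.nonneg ξ) hlt.le h.pos_left.le)
  have h1 : |ξ 1| ≤ c ^ b := (h.abs_one_le ξ).trans
    (Real.rpow_le_rpow (h.nonneg ξ) hlt.le h.pos_right.le)
  have h2 : ‖ξ‖ ≤ |ξ 0| + |ξ 1| := by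
    rw [EuclideanSpace.norm_eq, Fin.sum_univ_two]
    refine Real.sqrt_le_iff.2 ⟨by positivity, ?_⟩
    simp only [Real.norm_eq_abs]
    nlinarith [abs_nonneg (ξ 0), abs_nonneg (ξ 1)]
  linarith

/-- There are cutoffs which equal `1` near the origin and which make the low-frequency part of a
given function small. -/
theorem IsDissipative.exists_cutoff (h : IsDissipative M a b K) (f : L2C) {η : ℝ} (hη : 0 < η) :
    ∃ (χ : Plane → ℝ) (hχ : IsCutoff M χ) (ε : ℝ), 0 < ε ∧ (∀ ξ, ‖ξ‖ ≤ ε → χ ξ = 1) ∧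
      ‖hχ.cut f‖ ^ 2 ≤ η := by
  obtain ⟨r, hr, hrM⟩ := Metric.eventually_nhds_iff.1 h.eventually_le_one
  have hfin : ∫⁻ ξ, ‖f ξ‖ₑ ^ 2 ≠ ⊤ := by
    rw [← enorm_sq_eq_lintegral]
    finiteness
  -- By absolute continuity of the integral, `f` has little mass on any set of small measure, in
  -- particular on a small ball.
  obtain ⟨δ, hδ, hδf⟩ := exists_pos_setLIntegral_lt_of_measure_lt hfin
    (ENNReal.ofReal_pos.2 hη).ne'
  have hlim : Tendsto (fun ε : ℝ => volume (Metric.ball (0 : Plane) (2 * ε))) (𝓝 0) (𝓝 0) := by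
    simp only [EuclideanSpace.volume_ball_fin_two]
    have : Tendsto (fun ε : ℝ => ENNReal.ofReal (2 * ε) ^ 2 * ENNReal.ofReal Real.pi) (𝓝 0)
        (𝓝 (ENNReal.ofReal (2 * 0) ^ 2 * ENNReal.ofReal Real.pi)) := by
      refine ENNReal.Tendsto.mul_const ?_ (Or.inr ENNReal.ofReal_ne_top)
      refine ((ENNReal.continuous_pow 2).tendsto _).comp (ENNReal.tendsto_ofReal ?_)
      exact (continuous_const_mul 2).tendsto 0
    simpa using this
  have hev : ∀ᶠ ε in 𝓝[>] (0 : ℝ), volume (Metric.ball (0 : Plane) (2 * ε)) < δ ∧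
      2 * ε < r ∧ 0 < ε := by
    refine ((hlim.eventually_lt_const hδ).filter_mono nhdsWithin_le_nhds).and
      (Eventually.and (Eventually.filter_mono nhdsWithin_le_nhds ?_) self_mem_nhdsWithin)
    have h2 := (continuous_const_mul (2 : ℝ)).tendsto 0
    rw [mul_zero] at h2
    exact h2.eventually_lt_const hr
  obtain ⟨ε, hεδ, hεr, hε⟩ := hev.exists
  let χ : ContDiffBump (0 : Plane) := ⟨ε, 2 * ε, hε, by linarith⟩
  have hsupp : ∀ ξ, χ ξ ≠ 0 → ξ ∈ Metric.ball (0 : Plane) (2 * ε) := fun ξ hξ => by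
    rw [← show Function.support χ = Metric.ball (0 : Plane) (2 * ε) from χ.support_eq]
    exact hξ
  have hχ : IsCutoff M χ :=
    { contDiff := χ.contDiff
      hasCompactSupport := χ.hasCompactSupport
      nonneg := χ.nonneg'
      le_one := fun _ => χ.le_one
      symbol_le := fun ξ hξ => hrM ((Metric.mem_ball.1 (hsupp ξ hξ)).trans hεr) }
  refine ⟨χ, hχ, ε, hε, fun ξ hξ => χ.one_of_mem_closedBall (by simpa using hξ), ?_⟩
  have hle : ‖hχ.cut f‖ₑ ^ 2 ≤ ENNReal.ofReal η := by
    rw [enorm_sq_eq_lintegral]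
    refine le_trans ?_ (hδf _ hεδ).le
    rw [← lintegral_indicator Metric.isOpen_ball.measurableSet]
    refine lintegral_mono_ae ?_
    filter_upwards [hχ.coeFn_cut f] with ξ hξ
    rw [hξ]
    by_cases h0 : χ ξ = 0
    · simp [h0]
    · rw [Set.indicator_of_mem (hsupp ξ h0), enorm_mul]
      gcongr
      refine mul_le_of_le_one_left zero_le ?_
      rw [← ofReal_norm, Complex.norm_real, Real.norm_of_nonneg χ.nonneg]
      exact ENNReal.ofReal_le_one.2 χ.le_one
  rw [← ofReal_norm, ← ENNReal.ofReal_pow (norm_nonneg _)] at hle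
  exact (ENNReal.ofReal_le_ofReal_iff hη.le).1 hle

/-- The energy is bounded by the low-frequency energy and the dissipation. -/
theorem IsCutoff.enorm_sq_le {χ : Plane → ℝ} (hχ : IsCutoff M χ) {ε c : ℝ} (hc : 0 < c)
    (hε : ∀ ξ, ‖ξ‖ ≤ ε → χ ξ = 1) (hM : ∀ ξ, ε ≤ ‖ξ‖ → c ≤ M ξ) (f : L2C) :
    ‖f‖ₑ ^ 2 ≤ ‖hχ.cut f‖ₑ ^ 2 +
      (ENNReal.ofReal c)⁻¹ * ∫⁻ ξ, ENNReal.ofReal (M ξ) * ‖f ξ‖ₑ ^ 2 := by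
  have hcm : Measurable fun ξ => ‖hχ.cut f ξ‖ₑ ^ 2 :=
    (Lp.stronglyMeasurable _).measurable.enorm.pow_const 2
  have hc0 : ENNReal.ofReal c ≠ 0 := (ENNReal.ofReal_pos.2 hc).ne'
  rw [enorm_sq_eq_lintegral, enorm_sq_eq_lintegral,
    ← lintegral_const_mul' _ _ (ENNReal.inv_ne_top.2 hc0), ← lintegral_add_left hcm]
  refine lintegral_mono_ae ?_
  filter_upwards [hχ.coeFn_cut f] with ξ hξ
  rw [hξ]
  rcases le_total ‖ξ‖ ε with h | h
  · simp [hε ξ h]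
  · refine le_trans ?_ le_add_self
    calc ‖f ξ‖ₑ ^ 2 = (ENNReal.ofReal c)⁻¹ * (ENNReal.ofReal c * ‖f ξ‖ₑ ^ 2) := by
          rw [← mul_assoc, ENNReal.inv_mul_cancel hc0 ENNReal.ofReal_ne_top, one_mul]
      _ ≤ _ := by
          gcongr
          exact hM ξ h

end Cutoff

/-! ### Decay of the energy. -/

section Decay

variable {m : Plane → ℝ} {a b K : ℝ} {θ₀ : L2} {θ : ℝ → L2}

theorem IsWeakSolution.lintegral_dissipation_le (h : IsWeakSolution m θ₀ θ) (t : ℝ) (ht : 0 ≤ t) :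
    ∫⁻ τ in Set.Ioc 0 t, dissipation m (θ τ) ≤ ENNReal.ofReal (‖θ₀‖ ^ 2) := by
  have h1 := le_add_self.trans (h.energy_zero t ht)
  refine le_trans ?_ h1
  rw [two_mul]
  exact le_self_add

/-- The low-frequency energy grows at most by the dissipation. -/
theorem IsDissipativeSolution.cut_energy_le (h : IsDissipativeSolution m a b K θ₀ θ)
    {χ : Plane → ℝ} (hχ : IsCutoff (fun ξ => m (freq ξ)) χ) {s t : ℝ} (hs : 0 ≤ s) (hst : s ≤ t) :
    ENNReal.ofReal (‖hχ.cut (hat θ t)‖ ^ 2 - ‖hχ.cut (hat θ s)‖ ^ 2) ≤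
      fluxConst a b K * ‖θ₀‖ₑ * ∫⁻ τ in Set.Ioc s t, dissipation m (θ τ) := by
  obtain ⟨C, hC, hloc⟩ := h.exists_cut_energy_le hχ
  rw [← lintegral_const_mul' _ _ (ENNReal.mul_ne_top fluxConst_ne_top enorm_ne_top)]
  exact ofReal_sub_le_of_local (E := fun t => ‖hχ.cut (hat θ t)‖ ^ 2) hC hst
    fun s' t' hs' hst' => hloc s' t' (hs.trans hs') hst'

/-- In every time interval of length one there is a time at which the dissipation is small and from
which on the energy inequality holds. -/
theorem IsWeakSolution.exists_good_time (h : IsWeakSolution m θ₀ θ) {s : ℝ} (hs : 0 ≤ s)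
    {δ : ℝ} (hδ : 0 < δ)
    (hle : ∫⁻ τ in Set.Ioc s (s + 1), dissipation m (θ τ) ≤ ENNReal.ofReal (δ / 2)) :
    ∃ τ ∈ Set.Ioc s (s + 1), dissipation m (θ τ) ≤ ENNReal.ofReal δ ∧
      ∀ t, τ ≤ t → EnergyInequality m θ τ t (θ τ) := by
  -- Otherwise the dissipation is at least `δ` almost everywhere on an interval of length one,
  -- against the bound `δ / 2`.
  by_contra! hcon
  have hae : ∀ᵐ τ ∂(volume.restrict (Set.Ioc s (s + 1))),
      ENNReal.ofReal δ ≤ dissipation m (θ τ) := by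
    filter_upwards [ae_restrict_of_ae_restrict_of_subset
      (fun τ hτ => hs.trans_lt hτ.1 : Set.Ioc s (s + 1) ⊆ Set.Ioi 0) h.energy_ae,
      ae_restrict_mem measurableSet_Ioc] with τ h1 h2
    by_contra! hlt
    obtain ⟨t, ht, hnot⟩ := hcon τ h2 hlt.le
    exact hnot (h1 t ht)
  have h1 := (lintegral_mono_ae hae).trans hle
  rw [lintegral_const, Measure.restrict_apply_univ, Real.volume_Ioc, add_sub_cancel_left,
    ENNReal.ofReal_one, mul_one, ENNReal.ofReal_le_ofReal_iff (by positivity)] at h1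
  linarith

theorem IsDissipativeSolution.eventually_norm_sq_le (h : IsDissipativeSolution m a b K θ₀ θ)
    {η : ℝ} (hη : 0 < η) : ∀ᶠ t in atTop, ‖θ t‖ ^ 2 ≤ 3 * η := by
  have hM := h.isDissipative.comp_freq
  have hw := h.isWeakSolution
  set κ := fluxConst a b K * ‖θ₀‖ₑ with hκ
  have hκt : κ ≠ ⊤ := ENNReal.mul_ne_top fluxConst_ne_top enorm_ne_top
  have htail := fun {δ : ℝ≥0∞} (hδ : δ ≠ 0) (s : ℝ) =>
    exists_tail_le ENNReal.ofReal_ne_top hw.lintegral_dissipation_le hδ s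
  -- The time `s` can be fixed before the cutoff because `κ` does not involve `χ`. The `+ 1` keeps
  -- the denominator nonzero when `κ = 0`.
  obtain ⟨s, hs, -, hs_tail⟩ := htail (δ := ENNReal.ofReal η / (κ + 1))
    (ENNReal.div_pos (ENNReal.ofReal_pos.2 hη).ne' (by finiteness)).ne' 0
  obtain ⟨χ, hχ, ε, hε, hχ1, hcut⟩ := hM.exists_cutoff (hat θ s) hη
  have hlow : ∀ t, s ≤ t → ‖hχ.cut (hat θ t)‖ ^ 2 ≤ 2 * η := by
    intro t ht
    have h1 : ENNReal.ofReal (‖hχ.cut (hat θ t)‖ ^ 2 - ‖hχ.cut (hat θ s)‖ ^ 2) ≤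
        ENNReal.ofReal η := by
      refine (h.cut_energy_le hχ hs ht).trans ?_
      calc κ * ∫⁻ τ in Set.Ioc s t, dissipation m (θ τ)
          ≤ (κ + 1) * (ENNReal.ofReal η / (κ + 1)) := by
            gcongr
            · exact le_self_add
            · exact hs_tail t ht
        _ = ENNReal.ofReal η := ENNReal.mul_div_cancel (by simp) (by finiteness)
    rw [ENNReal.ofReal_le_ofReal_iff hη.le] at h1
    linarith
  obtain ⟨c, hc, hcM⟩ := hM.exists_pos_le_symbol hε
  -- Once the cutoff has fixed `c`, a later time makes the dissipation at most `c * η`, hence the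
  -- high-frequency energy at most `η`, on top of `2 * η` from low frequencies.
  obtain ⟨r, hr, hsr, hr_tail⟩ := htail (δ := ENNReal.ofReal (c * η / 2))
    (ENNReal.ofReal_pos.2 (by positivity)).ne' s
  obtain ⟨τ, hτ, hτD, hτE⟩ := hw.exists_good_time hr (δ := c * η) (by positivity)
    (hr_tail _ (by linarith))
  have hτη : ‖θ τ‖ ^ 2 ≤ 3 * η := by
    have h1 := hχ.enorm_sq_le hc hχ1 hcM (hat θ τ)
    rw [lintegral_hat_eq_dissipation] at h1
    have h2 : (ENNReal.ofReal c)⁻¹ * dissipation m (θ τ) ≤ ENNReal.ofReal η := by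
      calc _ ≤ (ENNReal.ofReal c)⁻¹ * ENNReal.ofReal (c * η) := by gcongr
        _ = _ := by
          rw [ENNReal.ofReal_mul hc.le, ← mul_assoc, ENNReal.inv_mul_cancel
            (ENNReal.ofReal_pos.2 hc).ne' ENNReal.ofReal_ne_top, one_mul]
    have h3 := h1.trans (add_le_add_right h2 _)
    rw [← ofReal_norm, ← ofReal_norm, ← ENNReal.ofReal_pow (norm_nonneg _),
      ← ENNReal.ofReal_pow (norm_nonneg _), ← ENNReal.ofReal_add (by positivity) hη.le,
      ENNReal.ofReal_le_ofReal_iff (by positivity), norm_hat] at h3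
    linarith [hlow τ (hsr.trans hτ.1.le)]
  filter_upwards [eventually_ge_atTop τ] with t ht
  have h1 := le_self_add.trans (hτE t ht)
  rw [ENNReal.ofReal_le_ofReal_iff (by positivity)] at h1
  exact h1.trans hτη

theorem IsDissipativeSolution.tendsto_norm (h : IsDissipativeSolution m a b K θ₀ θ) :
    Tendsto (fun t : ℝ => ‖θ t‖) atTop (𝓝 0) := by
  rw [Metric.tendsto_nhds]
  intro ε hε
  filter_upwards [h.eventually_norm_sq_le (η := ε ^ 2 / 6) (by positivity)] with t ht
  rw [Real.dist_0_eq_abs, abs_of_nonneg (norm_nonneg _)]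
  refine lt_of_pow_lt_pow_left₀ 2 hε.le ?_
  nlinarith [sq_pos_of_pos hε]

end Decay

end SQG

theorem proposition3p3 (α β : ℝ) (hα : 0 < α) (hβ : 0 < β)
    (hαβ : 4 * α * β ≤ min (α + 3 * β) (3 * α + β)) (θ₀ : SQG.L2) :
    (∀ θ : ℝ → SQG.L2, SQG.IsWeakSolution (SQG.anisoSymbol α β) θ₀ θ →
      Tendsto (fun t : ℝ => ‖θ t‖) atTop (𝓝 0)) ∧
    (α = β → ∀ θ : ℝ → SQG.L2, SQG.IsWeakSolution (SQG.isoSymbol α) θ₀ θ →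
      Tendsto (fun t : ℝ => ‖θ t‖) atTop (𝓝 0)) := by
  refine ⟨fun θ hθ => ?_, ?_⟩
  · exact SQG.IsDissipativeSolution.tendsto_norm
      ⟨hθ, SQG.isDissipative_aniso hα hβ hαβ, _, _, SQG.aniso_bound hα hβ⟩
  · rintro rfl θ hθ
    -- For equal exponents the hypothesis reads `4 α ^ 2 ≤ 4 α`.
    have hα1 : α ≤ 1 := by
      have := hαβ.trans (min_le_left _ _)
      nlinarith
    exact SQG.IsDissipativeSolution.tendsto_norm
      ⟨hθ, SQG.isDissipative_iso hα hα1, _, _, SQG.iso_bound hα⟩
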